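/- Let $k$ be a field, $R=k[x_1,\dots,x_n]$, ${\mathfrak m}=(x_1,\dots,x_n)$, and let $D=D_{R|k}$ be the ring of $k$-linear differential operators on $R$. For $\alpha\in\{0,1\}^n$ put $|\alpha|=\alpha_1+\cdots+\alpha_n$, ${\bf x}^\alpha=\prod_i x_i^{\alpha_i}$, ${\mathfrak p}_\alpha=(x_i\mid\alpha_i=1)$, let $\varepsilon_1,\dots,\varepsilon_n$ be the standard basis of ${\mathbb Z}^n$, ${\bf 1}=(1,\dots,1)$, and let $\mathrm{sign}(i,\alpha)=(-1)^{r-1}$ if $\alpha_i$ is the $r$-th nonzero component of $\alpha$. Localizations $M_{{\bf x}^\alpha}$ of a left $D$-module $M$, and its local cohomology modules $H^p_{{\mathfrak p}_\alpha}(M)$, computed as the cohomology of the Čech complex of $M$ on the generators $x_i$ ($\alpha_i=1$) of ${\mathfrak p}_\alpha$, carry their natural $D$-module structures. Let $M$ be a $D$-module with variation zero: there are $D$-submodules $0=F_{-1}\subseteq F_0\subseteq F_1\subseteq\cdots\subseteq F_n=M$ and integers $m_\alpha\ge 0$ such that for every $0\le j\le n$ $$F_j/F_{j-1}\;\cong\;\bigoplus_{|\alpha|=j}\bigl(H^{|\alpha|}_{{\mathfrak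 p}_\alpha}(R)\bigr)^{m_\alpha}\qquad\text{as $D$-modules.}$$ For $\alpha\in\{0,1\}^n$ let $$E_\alpha=R_{{\bf x}^{\bf 1}}\Big/\sum_{\alpha_i=1}R_{{\bf x}^{{\bf 1}-\varepsilon_i}},\qquad [N]_\alpha=\mathrm{Hom}_D(N,E_\alpha)$$ for any $D$-module $N$. When $\alpha_i=0$, let $u_{\alpha,i}:[M]_\alpha\to[M]_{\alpha+\varepsilon_i}$ be the canonical map, that is, the map induced by the natural epimorphism $E_\alpha\to E_{\alpha+\varepsilon_i}$. Let ${\mathcal M}^\bullet$ be the complex of $k$-vector spaces $$0\longleftarrow[M]_{\bf 1}\longleftarrow\bigoplus_{|\alpha|=n-1}[M]_\alpha\longleftarrow\cdots\longleftarrow\bigoplus_{|\alpha|=n-p}[M]_\alpha\longleftarrow\cdots\longleftarrow[M]_{\bf 0}\longleftarrow0$$ with $\bigoplus_{|\alpha|=n-p}[M]_\alpha$ in degree $p$, in which the component $[M]_\alpha\to[M]_{\alpha+\varepsilon_i}$ is $\mathrm{sign}(i,\alpha+\varepsilon_i)\,u_{\alpha,i}$. Let $\check C_{\mathfrak m}^\bullet(M)$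 be the Čech complex $$0\longrightarrow M\longrightarrow\bigoplus_{|\alpha|=1}M_{{\bf x}^\alpha}\longrightarrow\cdots\longrightarrow\bigoplus_{|\alpha|=p}M_{{\bf x}^\alpha}\longrightarrow\cdots\longrightarrow M_{{\bf x}^{\bf 1}}\longrightarrow0,$$ in which the component $M_{{\bf x}^\alpha}\to M_{{\bf x}^{\alpha+\varepsilon_i}}$ is $\mathrm{sign}(i,\alpha+\varepsilon_i)$ times the canonical localization map, and let $[\check C_{\mathfrak m}(M)]_{\bf 1}^\bullet$ be the complex of $k$-vector spaces obtained by applying $[-]_{\bf 1}=\mathrm{Hom}_D(-,E_{\bf 1})$ to it. Then there is an isomorphism of complexes of $k$-vector spaces $${\mathcal M}^\bullet\;\cong\;[\check C_{\mathfrak m}(M)]_{\bf 1}^\bullet .$$ In particular, $[H^p_{\mathfrak m}(M)]_{\bf 1}\cong H_p({\mathcal M}^\bullet)$ for every $p\ge 0$. -/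

import Mathlib

open CategoryTheory

universe u v

noncomputable section

namespace VarZero

/-! ### Grothendieck differential operators -/

lemma comm_mul_aux {S : Type*} [Ring S] (P Q a : S) :
    P * Q * a - a * (P * Q) = P * (Q * a - a * Q) + (P * a - a * P) * Q := by
  noncomm_ring

lemma comm_neg_aux {S : Type*} [Ring S] (P a : S) :
    -P * a - a * -P = -(P * a - a * P) := by
  noncomm_ring

lemma ore_step_aux {S : Type*} [Ring S] {P Q f : S} {d : ℕ}
    (h : f ^ (d + 1) * (P * f - f * P) = Q * f) :
    f ^ (d + 1 + 1) * P = (f ^ (d + 1) * P - Q) * f := by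
  rw [sub_mul, ← h, pow_succ f (d + 1)]
  noncomm_ring

lemma cancel_step_aux {S : Type*} [Ring S] {P f : S} {d : ℕ} (h0 : P * f = 0)
    (h : f ^ (d + 1) * (P * f - f * P) = 0) : f ^ (d + 1 + 1) * P = 0 := by
  rw [h0, zero_sub, mul_neg, neg_eq_zero, ← mul_assoc, ← pow_succ] at h
  exact h

section DiffOps

variable (k : Type u) (A : Type u) [Field k] [CommRing A] [Algebra k A]

/-- `IsDiffOp k A d P`: the `k`-linear endomorphism `P` of `A` is a differential operator of
order at most `d`, i.e. `d + 1` successive commutators with multiplications vanish. -/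
def IsDiffOp : ℕ → Module.End k A → Prop
  | 0, P => ∀ a : A, P * LinearMap.mulLeft k a - LinearMap.mulLeft k a * P = 0
  | d + 1, P => ∀ a : A, IsDiffOp d (P * LinearMap.mulLeft k a - LinearMap.mulLeft k a * P)

variable {k A}

lemma IsDiffOp.zero (d : ℕ) : IsDiffOp k A d 0 := by
  induction d with
  | zero => intro a; simp
  | succ d ih => intro a; simpa using ih

lemma IsDiffOp.succ {d : ℕ} {P : Module.End k A} (h : IsDiffOp k A d P) :
    IsDiffOp k A (d + 1) P := by
  induction d generalizing P with
  | zero => intro a; rw [h a]; exact IsDiffOp.zero 0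
  | succ d ih => intro a; exact ih (h a)

lemma IsDiffOp.mono {d e : ℕ} (hde : d ≤ e) {P : Module.End k A} (h : IsDiffOp k A d P) :
    IsDiffOp k A e P := by
  induction hde with
  | refl => exact h
  | step _ ih => exact ih.succ

lemma IsDiffOp.add {d : ℕ} {P Q : Module.End k A} (hP : IsDiffOp k A d P)
    (hQ : IsDiffOp k A d Q) : IsDiffOp k A d (P + Q) := by
  induction d generalizing P Q with
  | zero =>
    intro a
    have h1 := hP a
    have h2 := hQ a
    rw [add_mul, mul_add, add_sub_add_comm, h1, h2, add_zero]
  | succ d ih =>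
    intro a
    rw [add_mul, mul_add, add_sub_add_comm]
    exact ih (hP a) (hQ a)

lemma IsDiffOp.neg {d : ℕ} {P : Module.End k A} (hP : IsDiffOp k A d P) :
    IsDiffOp k A d (-P) := by
  induction d generalizing P with
  | zero =>
    intro a
    have h1 := hP a
    have h2 : -P * LinearMap.mulLeft k a - LinearMap.mulLeft k a * -P
      = -(P * LinearMap.mulLeft k a - LinearMap.mulLeft k a * P) := comm_neg_aux P _
    rw [h2, h1, neg_zero]
  | succ d ih =>
    intro a
    have h2 : -P * LinearMap.mulLeft k a - LinearMap.mulLeft k a * -P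
      = -(P * LinearMap.mulLeft k a - LinearMap.mulLeft k a * P) := comm_neg_aux P _
    rw [h2]
    exact ih (hP a)

lemma IsDiffOp.mul {d e : ℕ} {P Q : Module.End k A} (hP : IsDiffOp k A d P)
    (hQ : IsDiffOp k A e Q) : IsDiffOp k A (d + e) (P * Q) := by
  induction hs : d + e generalizing d e P Q with
  | zero =>
    obtain ⟨rfl, rfl⟩ : d = 0 ∧ e = 0 := by omega
    intro a
    rw [comm_mul_aux, hP a, hQ a, mul_zero, zero_mul, add_zero]
  | succ s ih =>
    intro a
    rw [comm_mul_aux]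
    refine IsDiffOp.add ?_ ?_
    · cases e with
      | zero => rw [hQ a, mul_zero]; exact IsDiffOp.zero _
      | succ e => exact ih hP (hQ a) (by omega)
    · cases d with
      | zero => rw [hP a, zero_mul]; exact IsDiffOp.zero _
      | succ d => exact ih (hP a) hQ (by omega)

lemma isDiffOp_mulLeft (a : A) : IsDiffOp k A 0 (LinearMap.mulLeft k a) := by
  intro b
  ext c
  simp [mul_left_comm]

variable (k A)

/-- The ring `D_{A|k}` of `k`-linear differential operators on `A`. -/
def diffOps : Subring (Module.End k A) where
  carrier := {P | ∃ d, IsDiffOp k A d P}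
  mul_mem' := by
    rintro P Q ⟨d, hP⟩ ⟨e, hQ⟩
    exact ⟨d + e, hP.mul hQ⟩
  one_mem' := ⟨0, fun a => by rw [one_mul, mul_one, sub_self]⟩
  add_mem' := by
    rintro P Q ⟨d, hP⟩ ⟨e, hQ⟩
    exact ⟨max d e, (hP.mono (le_max_left d e)).add (hQ.mono (le_max_right d e))⟩
  zero_mem' := ⟨0, IsDiffOp.zero 0⟩
  neg_mem' := by
    rintro P ⟨d, hP⟩
    exact ⟨d, hP.neg⟩

/-- The inclusion of `A` in `D_{A|k}` as operators of order zero. -/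
def mulOp : A →+* diffOps k A where
  toFun a := ⟨LinearMap.mulLeft k a, 0, isDiffOp_mulLeft a⟩
  map_one' := Subtype.ext (LinearMap.mulLeft_one k A)
  map_mul' a b := Subtype.ext (by ext c; simp)
  map_zero' := Subtype.ext (LinearMap.mulLeft_zero_eq_zero k A)
  map_add' a b := Subtype.ext (by ext c; simp [add_mul])

/-- `D_{A|k}` is a `k`-algebra, with `(c • P) a = c • P a`. -/
instance : Algebra k (diffOps k A) where
  smul c P := ⟨c • P.1, by
    have h : c • P.1 = (mulOp k A (algebraMap k A c)).1 * P.1 := by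
      ext a; simp [mulOp, Algebra.smul_def]
    rw [h]
    exact (diffOps k A).mul_mem (mulOp k A (algebraMap k A c)).2 P.2⟩
  algebraMap := (mulOp k A).comp (algebraMap k A)
  commutes' c P := Subtype.ext <| by
    ext a
    change algebraMap k A c * P.1 a = P.1 (algebraMap k A c * a)
    rw [← Algebra.smul_def, ← Algebra.smul_def, map_smul]
  smul_def' c P := Subtype.ext <| by
    ext a
    exact Algebra.smul_def c (P.1 a)

instance : IsScalarTower k (diffOps k A) A := ⟨fun _ _ _ => rfl⟩

variable {k A}

lemma ore_aux {d : ℕ} (f : A) (P : diffOps k A) (hP : IsDiffOp k A d P) :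
    ∃ Q : diffOps k A, mulOp k A f ^ (d + 1) * P = Q * mulOp k A f := by
  induction d generalizing P with
  | zero =>
    refine ⟨P, ?_⟩
    rw [zero_add, pow_one]
    exact Subtype.ext (sub_eq_zero.mp (hP f)).symm
  | succ d ih =>
    obtain ⟨Q, hQ⟩ := ih (P * mulOp k A f - mulOp k A f * P) (hP f)
    exact ⟨mulOp k A f ^ (d + 1) * P - Q, ore_step_aux hQ⟩

lemma cancel_aux {d : ℕ} (f : A) (P : diffOps k A) (hP : IsDiffOp k A d P)
    (h0 : P * mulOp k A f = 0) : mulOp k A f ^ (d + 1) * P = 0 := by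
  induction d generalizing P with
  | zero =>
    have h : P * mulOp k A f - mulOp k A f * P = 0 := Subtype.ext (hP f)
    rw [h0, zero_sub, neg_eq_zero] at h
    rwa [zero_add, pow_one]
  | succ d ih =>
    have h := ih (P * mulOp k A f - mulOp k A f * P) (hP f)
      (by rw [sub_mul, mul_assoc _ P, h0, zero_mul, mul_zero, sub_zero])
    exact cancel_step_aux h0 h

/-- A multiplicative subset of `A` is a left denominator set in `D_{A|k}`. -/
instance oreSet (T : Submonoid A) : OreLocalization.OreSet (T.map (mulOp k A)) :=
  Classical.choice <| OreLocalization.nonempty_oreSet_iff.mpr <| by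
    constructor
    · rintro r₁ r₂ ⟨_, f, hf, rfl⟩ h
      obtain ⟨d, hd⟩ := (r₁ - r₂).2
      have h0 := cancel_aux f (r₁ - r₂) hd (by rw [sub_mul]; exact sub_eq_zero.mpr h)
      refine ⟨⟨mulOp k A f ^ (d + 1), f ^ (d + 1), pow_mem hf _, by simp⟩, ?_⟩
      rw [mul_sub] at h0
      exact sub_eq_zero.mp h0
    · rintro r ⟨_, f, hf, rfl⟩
      obtain ⟨d, hd⟩ := r.2
      obtain ⟨Q, hQ⟩ := ore_aux f r hd
      exact ⟨Q, ⟨mulOp k A f ^ (d + 1), f ^ (d + 1), pow_mem hf _, by simp⟩, hQ⟩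

end DiffOps

/-! ### Ore localization of modules, cubes of modules and their complexes -/

section OreMap

variable {D : Type u} [Ring D] (M : Type v) [AddCommGroup M] [Module D M]

/-- The canonical map `S⁻¹M → T⁻¹M`, `m/s ↦ m/s`, for Ore sets `S ≤ T`. -/
def oreMap {S T : Submonoid D} [OreLocalization.OreSet S] [OreLocalization.OreSet T]
    (h : S ≤ T) : OreLocalization S M →ₗ[D] OreLocalization T M where
  toFun := OreLocalization.liftExpand
    (fun m s => OreLocalization.oreDiv m ⟨s.1, h s.2⟩)
    (fun m t s ht => OreLocalization.expand m ⟨s.1, h s.2⟩ t (h ht))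
  map_add' x y := by
    induction x using OreLocalization.ind with | _ m s
    induction y using OreLocalization.ind with | _ m' s'
    obtain ⟨r, t, hrt⟩ := OreLocalization.oreCondition (s : D) s'
    rw [OreLocalization.oreDiv_add_char s s' r t hrt]
    simp only [OreLocalization.liftExpand_of]
    rw [OreLocalization.oreDiv_add_char (⟨s.1, h s.2⟩ : T) ⟨s'.1, h s'.2⟩ r ⟨t.1, h t.2⟩ hrt]
    rfl
  map_smul' P x := by
    induction x using OreLocalization.ind with | _ m s
    obtain ⟨r, t, hrt⟩ := OreLocalization.oreCondition P s
    rw [RingHom.id_apply, ← OreLocalization.oreDiv_one_smul P (OreLocalization.oreDiv m s),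
      OreLocalization.oreDiv_smul_char P m 1 s r t hrt]
    simp only [OreLocalization.liftExpand_of]
    rw [← OreLocalization.oreDiv_one_smul P
        (OreLocalization.oreDiv m (⟨s.1, h s.2⟩ : T)),
      OreLocalization.oreDiv_smul_char P m 1 ⟨s.1, h s.2⟩ r ⟨t.1, h t.2⟩ hrt]
    congr 1

lemma oreMap_refl {S : Submonoid D} [OreLocalization.OreSet S] (h : S ≤ S) :
    oreMap M h = LinearMap.id := by
  ext x
  induction x using OreLocalization.ind with | _ m s
  rfl

lemma oreMap_comp {S T U : Submonoid D} [OreLocalization.OreSet S] [OreLocalization.OreSet T]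
    [OreLocalization.OreSet U] (h : S ≤ T) (h' : T ≤ U) :
    oreMap M h' ∘ₗ oreMap M h = oreMap M (h.trans h') := by
  ext x
  induction x using OreLocalization.ind with | _ m s
  rfl

/-- The cube of localizations of `M` at an increasing family of Ore sets. -/
def oreCube {n : ℕ} (S : Finset (Fin n) → Submonoid D) [∀ A, OreLocalization.OreSet (S A)]
    (hS : Monotone S) : Finset (Fin n) ⥤ ModuleCat.{max u v} D where
  obj A := ModuleCat.of D (OreLocalization (S A) M)
  map f := ModuleCat.ofHom (oreMap M (hS (leOfHom f)))
  map_id A := by rw [oreMap_refl]; rfl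
  map_comp f g := by rw [← ModuleCat.ofHom_comp, oreMap_comp]

end OreMap

section HomFunctor

variable {k : Type u} [Field k] {D : Type u} [Ring D] [Algebra k D]

/-- Postcomposition with a `D`-linear map, as a `k`-linear map. -/
def postcomp (M : Type*) [AddCommGroup M] [Module D M] {E E' : Type*} [AddCommGroup E]
    [Module D E] [Module k E] [IsScalarTower k D E] [AddCommGroup E'] [Module D E'] [Module k E']
    [IsScalarTower k D E'] (g : E →ₗ[D] E') : (M →ₗ[D] E) →ₗ[k] (M →ₗ[D] E') where
  toFun f := g ∘ₗ f
  map_add' f f' := LinearMap.comp_add f f' g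
  map_smul' c f := by
    ext m
    exact LinearMap.map_smul_of_tower g c (f m)

/-- Precomposition with a `D`-linear map, as a `k`-linear map. -/
def precomp {M N : Type*} [AddCommGroup M] [Module D M] [AddCommGroup N] [Module D N]
    (E : Type*) [AddCommGroup E] [Module D E] [Module k E] [IsScalarTower k D E]
    (g : M →ₗ[D] N) : (N →ₗ[D] E) →ₗ[k] (M →ₗ[D] E) where
  toFun f := f ∘ₗ g
  map_add' _ _ := rfl
  map_smul' _ _ := rfl

variable (k)

/-- For an increasing family of submodules `K A` of a `D`-module `E`, the cube with vertices
`Hom_D(M, E / K A)` and maps induced by the natural epimorphisms `E / K A → E / K B`. -/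
def homQuotCube (M : Type v) [AddCommGroup M] [Module D M] {E : Type u} [AddCommGroup E]
    [Module D E] [Module k E] [IsScalarTower k D E] {n : ℕ} (K : Finset (Fin n) → Submodule D E)
    (hK : Monotone K) : Finset (Fin n) ⥤ ModuleCat.{max u v} k where
  obj A := ModuleCat.of k (M →ₗ[D] (E ⧸ K A))
  map f := ModuleCat.ofHom (postcomp M (Submodule.factor (hK (leOfHom f))))
  map_id A := by
    ext f m
    exact congrArg (fun g : (E ⧸ K A) →ₗ[D] (E ⧸ K A) => g (f m))
      (show Submodule.factor (le_refl (K A)) = LinearMap.id by ext x; rfl)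
  map_comp {A B C} f g := by
    ext φ m
    exact congrArg (fun g : (E ⧸ K A) →ₗ[D] (E ⧸ K C) => g (φ m))
      (show Submodule.factor (hK (leOfHom (f ≫ g))) =
        Submodule.factor (hK (leOfHom g)) ∘ₗ Submodule.factor (hK (leOfHom f)) by
        ext x; rfl)

/-- The complex of `k`-vector spaces obtained by applying the contravariant functor
`Hom_D(-, E)` termwise to a complex of `D`-modules. -/
def homComplex (K : CochainComplex (ModuleCat.{max u v} D) ℕ) (E : Type u) [AddCommGroup E]
    [Module D E] [Module k E] [IsScalarTower k D E] :
    ChainComplex (ModuleCat.{max u v} k) ℕ where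
  X p := ModuleCat.of k (K.X p →ₗ[D] E)
  d i j := ModuleCat.ofHom (precomp E (K.d j i).hom)
  shape i j hij := by
    rw [K.shape j i hij]
    ext f m
    exact map_zero f
  d_comp_d' i j l _ _ := by
    ext f m
    have h : (K.d j i).hom ((K.d l j).hom m) = 0 :=
      congrArg (fun g => g.hom m) (K.d_comp_d l j i)
    change f ((K.d j i).hom ((K.d l j).hom m)) = 0
    rw [h, map_zero]

end HomFunctor

/-- The sign `sgn i C = (-1)^(r-1)` if `i` is the `r`-th smallest element of `C`. Throughout,
exponents `α ∈ {0,1}^n` are identified with their supports, subsets of `Fin n`: `|α|` is the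
cardinality and `α + ε_i` adds the element `i`. -/
def sgn {n : ℕ} (i : Fin n) (C : Finset (Fin n)) : ℤ :=
  (-1) ^ (C.filter (· < i)).card

section Cube

variable {S : Type u} [Ring S] {n : ℕ} (Q : Finset (Fin n) ⥤ ModuleCat.{v} S)

/-- For a cube `Q` of modules (covariant for inclusion of subsets), the map from the product of
the vertices in `P` to the product of the vertices in `P'` whose component `Q(C \ i) → Q(C)` is
`sgn i C` times the structure map. -/
def cubeD (P P' : Finset (Fin n) → Prop) (h : ∀ C, P' C → ∀ i ∈ C, P (C.erase i)) :
    (∀ B : {B // P B}, Q.obj B.1) →ₗ[S] (∀ C : {C // P' C}, Q.obj C.1) :=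
  LinearMap.pi fun C => ∑ i ∈ C.1.attach,
    sgn i.1 C.1 • ((Q.map (homOfLE (C.1.erase_subset i.1))).hom ∘ₗ
      LinearMap.proj (⟨C.1.erase i.1, h C.1 C.2 i.1 i.2⟩ : {B // P B}))

lemma sgn_swap {C : Finset (Fin n)} {i j : Fin n} (hi : i ∈ C) (hj : j ∈ C) (hij : i ≠ j) :
    sgn i C * sgn j (C.erase i) + sgn j C * sgn i (C.erase j) = 0 := by
  wlog hlt : i < j generalizing i j
  · rw [add_comm]
    exact this hj hi hij.symm (lt_of_le_of_ne (not_lt.mp hlt) hij.symm)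
  have h1 : (C.erase j).filter (· < i) = C.filter (· < i) := by
    ext a; simp only [Finset.mem_filter, Finset.mem_erase]
    constructor
    · rintro ⟨⟨_, h⟩, h'⟩; exact ⟨h, h'⟩
    · rintro ⟨h, h'⟩; exact ⟨⟨(h'.trans hlt).ne, h⟩, h'⟩
  have h2 : (C.erase i).filter (· < j) = (C.filter (· < j)).erase i := by
    ext a; simp only [Finset.mem_filter, Finset.mem_erase]; tauto
  have h3 : ((C.filter (· < j)).erase i).card + 1 = (C.filter (· < j)).card :=
    Finset.card_erase_add_one (by simp [hi, hlt])
  unfold sgn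
  rw [h1, h2, ← h3, pow_succ]
  ring

lemma cubeD_comp (P P' P'' : Finset (Fin n) → Prop) (h : ∀ C, P' C → ∀ i ∈ C, P (C.erase i))
    (h' : ∀ C, P'' C → ∀ i ∈ C, P' (C.erase i)) :
    cubeD Q P' P'' h' ∘ₗ cubeD Q P P' h = 0 := by
  refine LinearMap.ext fun w => funext fun C => ?_
  have hcongr : ∀ (B B' : {B // P B}) (hB : B.1 ≤ C.1) (hB' : B'.1 ≤ C.1), B = B' →
      (Q.map (homOfLE hB)).hom (w B) = (Q.map (homOfLE hB')).hom (w B') := by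
    rintro B _ _ _ rfl; rfl
  have hcomp : ∀ (B B' : Finset (Fin n)) (h1 : B ≤ B') (h2 : B' ≤ C.1) (x : Q.obj B),
      (Q.map (homOfLE h2)).hom ((Q.map (homOfLE h1)).hom x)
        = (Q.map (homOfLE (h1.trans h2))).hom x := by
    intro B B' h1 h2 x
    rw [← homOfLE_comp h1 h2, Q.map_comp]; rfl
  simp only [cubeD, LinearMap.comp_apply, LinearMap.pi_apply, LinearMap.sum_apply,
    LinearMap.smul_apply, LinearMap.proj_apply, map_sum, LinearMap.zero_apply, Pi.zero_apply,
    map_zsmul, hcomp, Finset.smul_sum, smul_smul]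
  rw [Finset.sum_sigma']
  refine Finset.sum_involution
    (fun x _ => ⟨⟨x.2.1, Finset.mem_of_mem_erase x.2.2⟩,
      ⟨x.1.1, Finset.mem_erase.mpr ⟨(Finset.ne_of_mem_erase x.2.2).symm, x.1.2⟩⟩⟩)
    ?_ ?_ ?_ ?_
  · rintro ⟨⟨i, hi⟩, ⟨j, hj⟩⟩ _
    obtain ⟨hji, hjC⟩ := Finset.mem_erase.mp hj
    have e := hcongr ⟨(C.1.erase j).erase i, h _ (h' _ C.2 j hjC) i
        (Finset.mem_erase.mpr ⟨hji.symm, hi⟩)⟩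
      ⟨(C.1.erase i).erase j, h _ (h' _ C.2 i hi) j hj⟩
      (((C.1.erase j).erase_subset i).trans (C.1.erase_subset j))
      (((C.1.erase i).erase_subset j).trans (C.1.erase_subset i))
      (Subtype.ext Finset.erase_right_comm)
    dsimp only at e ⊢
    rw [e, ← add_smul, sgn_swap hi hjC hji.symm, zero_smul]
  · rintro ⟨⟨i, hi⟩, ⟨j, hj⟩⟩ _ _ heq
    have := congrArg (fun x => x.1.1) heq
    exact (Finset.ne_of_mem_erase hj) this
  · intros; simp
  · intros; rfl

end Cube

/-! ### D-modules over the polynomial ring -/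

/-- The polynomial ring `R = k[x_1, …, x_n]`. -/
abbrev Poly (k : Type u) [Field k] (n : ℕ) : Type u := MvPolynomial (Fin n) k

/-- The ring `D = D_{R|k}` of `k`-linear differential operators on `R = k[x_1, …, x_n]`. -/
def Diff (k : Type u) [Field k] (n : ℕ) : Type u := diffOps k (Poly k n)

section Diff

variable (k : Type u) [Field k] (n : ℕ)

instance : Ring (Diff k n) := inferInstanceAs (Ring (diffOps k (Poly k n)))

instance : Algebra k (Diff k n) := inferInstanceAs (Algebra k (diffOps k (Poly k n)))

instance : Module (Diff k n) (Poly k n) :=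
  inferInstanceAs (Module (diffOps k (Poly k n)) (Poly k n))

/-- The inclusion of `R` in `D` as multiplication operators. -/
def mul : Poly k n →+* Diff k n := mulOp k (Poly k n)

/-- The monomials in the variables `x_i`, `i ∈ A`, viewed in `D`. -/
def monoms (A : Finset (Fin n)) : Submonoid (Diff k n) :=
  (Submonoid.closure ((fun i => (MvPolynomial.X i : Poly k n)) '' (A : Set (Fin n)))).map (mul k n)

instance (A : Finset (Fin n)) : OreLocalization.OreSet (monoms k n A) :=
  oreSet (k := k) (Submonoid.closure ((fun i => (MvPolynomial.X i : Poly k n)) '' (A : Set (Fin n))))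

lemma monoms_mono : Monotone (monoms k n) := fun _ _ h =>
  Submonoid.monotone_map (Submonoid.closure_mono (Set.image_mono (Finset.coe_subset.mpr h)))

/-- The localization `M_{x^A}` of a `D`-module, obtained by inverting the variables `x_i`, `i ∈ A`
(equivalently their product `x^A`), with its `D`-module structure. -/
abbrev Loc (M : Type v) [AddCommGroup M] [Module (Diff k n) M] (A : Finset (Fin n)) :
    Type (max u v) :=
  OreLocalization (monoms k n A) M

/-- The cube of localizations `A ↦ M_{x^A}`, with the canonical localization maps. -/
def locCube (M : Type v) [AddCommGroup M] [Module (Diff k n) M] :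
    Finset (Fin n) ⥤ ModuleCat.{max u v} (Diff k n) :=
  oreCube M (monoms k n) (monoms_mono k n)

/-- The Čech complex of `M` on the variables `x_i`, `i ∈ A`, i.e. with respect to the face ideal
`𝔭_A = (x_i | i ∈ A)`: in degree `p` the sum of the `M_{x^B}` with `B ⊆ A`, `|B| = p`; the
component `M_{x^B} → M_{x^{B ∪ i}}` of the differential is `sgn i (B ∪ i)` times the canonical
map. -/
def cech (M : Type v) [AddCommGroup M] [Module (Diff k n) M] (A : Finset (Fin n)) :
    CochainComplex (ModuleCat.{max u v} (Diff k n)) ℕ :=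
  CochainComplex.of
    (fun p => ModuleCat.of (Diff k n)
      (∀ B : {B : Finset (Fin n) // B ⊆ A ∧ B.card = p}, (locCube k n M).obj B.1))
    (fun p => ModuleCat.ofHom (cubeD (locCube k n M) (fun B => B ⊆ A ∧ B.card = p)
      (fun B => B ⊆ A ∧ B.card = p + 1)
      (fun C hC i hi => ⟨(C.erase_subset i).trans hC.1, by
        rw [Finset.card_erase_of_mem hi, hC.2, Nat.add_sub_cancel]⟩)))
    (fun p => by rw [← ModuleCat.ofHom_comp, cubeD_comp]; rfl)

/-- The local cohomology `D`-module `H^p_{𝔭_A}(M)`: the cohomology of the Čech complex of `M` on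
the generators `x_i`, `i ∈ A`, of `𝔭_A`. -/
abbrev localCoh (M : Type v) [AddCommGroup M] [Module (Diff k n) M] (A : Finset (Fin n)) (p : ℕ) :
    ModuleCat.{max u v} (Diff k n) :=
  (cech k n M A).homology p

/-- The full localization `R_{x^1} = R[1/(x_1 ⋯ x_n)]`. -/
def RLoc : Type u := Loc k n (Poly k n) Finset.univ

instance : AddCommGroup (RLoc k n) := inferInstanceAs (AddCommGroup (Loc k n (Poly k n) Finset.univ))

instance : Module (Diff k n) (RLoc k n) :=
  inferInstanceAs (Module (Diff k n) (Loc k n (Poly k n) Finset.univ))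

instance : Module k (RLoc k n) := Module.compHom _ (algebraMap k (Diff k n))

instance : IsScalarTower k (Diff k n) (RLoc k n) :=
  IsScalarTower.of_algebraMap_smul fun _ _ => rfl

/-- The natural map `R_{x^A} → R_{x^1}`. -/
def toRLoc (A : Finset (Fin n)) : Loc k n (Poly k n) A →ₗ[Diff k n] RLoc k n :=
  oreMap (Poly k n) (monoms_mono k n (Finset.subset_univ A))

/-- The submodule `∑_{i ∈ A} R_{x^{1 - ε_i}}` of `R_{x^1}`. -/
def injSub (A : Finset (Fin n)) : Submodule (Diff k n) (RLoc k n) :=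
  ⨆ i ∈ A, LinearMap.range (toRLoc k n (Finset.univ.erase i))

lemma injSub_mono : Monotone (injSub k n) := fun _ _ h => biSup_mono fun _ hi => h hi

/-- The module `E_A = R_{x^1} / ∑_{i ∈ A} R_{x^{1 - ε_i}}`. -/
abbrev Inj (A : Finset (Fin n)) : Type u := RLoc k n ⧸ injSub k n A

variable (M : Type v) [AddCommGroup M] [Module (Diff k n) M]

/-- The piece `[M]_A = Hom_D(M, E_A)`. -/
abbrev piece (A : Finset (Fin n)) : Type (max u v) := M →ₗ[Diff k n] Inj k n A

/-- The `n`-hypercube of `M`: vertices `[M]_A = Hom_D(M, E_A)`, canonical maps induced by the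
natural epimorphisms `E_A → E_B`, `A ⊆ B` (composites of the maps `u_{α,i}`). -/
def hypercube : Finset (Fin n) ⥤ ModuleCat.{max u v} k :=
  homQuotCube k M (injSub k n) (injSub_mono k n)

/-- The complex of `k`-vector spaces built from the `n`-hypercube: in degree `p` the sum of the
`[M]_A` with `|A| = n - p`; the component `[M]_A → [M]_{A ∪ i}` of the differential is
`sgn i (A ∪ i)` times the canonical map. -/
def hypercubeComplex : ChainComplex (ModuleCat.{max u v} k) ℕ :=
  ChainComplex.of
    (fun p => ModuleCat.of k
      (∀ A : {A : Finset (Fin n) // A.card + p = n}, (hypercube k n M).obj A.1))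
    (fun p => ModuleCat.ofHom (cubeD (hypercube k n M) (fun A => A.card + (p + 1) = n)
      (fun A => A.card + p = n)
      (fun C hC i hi => by have := Finset.card_erase_add_one hi; omega)))
    (fun p => by rw [← ModuleCat.ofHom_comp, cubeD_comp]; rfl)

/-- The degree `1` part of a complex of `D`-modules: apply `[-]_1 = Hom_D(-, E_1)` termwise. -/
def degOne (K : CochainComplex (ModuleCat.{max u v} (Diff k n)) ℕ) :
    ChainComplex (ModuleCat.{max u v} k) ℕ :=
  homComplex k K (Inj k n Finset.univ)

/-- `M` is a `D`-module with variation zero, an object of `D^T_{v=0}`: there is an increasing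
filtration `0 = F_{-1} ⊆ F_0 ⊆ ⋯ ⊆ F_n = M` by `D`-submodules and integers `m_A ≥ 0` such that
`F_j / F_{j-1}` is isomorphic to the direct sum over `|A| = j` of `H^{|A|}_{𝔭_A}(R)^{m_A}`.
Here `F j` stands for `F_{j-1}`. -/
def IsVariationZero : Prop :=
  ∃ (F : ℕ → Submodule (Diff k n) M) (m : Finset (Fin n) → ℕ),
    Monotone F ∧ F 0 = ⊥ ∧ F (n + 1) = ⊤ ∧
    ∀ j ≤ n, Nonempty ((F (j + 1) ⧸ (F j).submoduleOf (F (j + 1))) ≃ₗ[Diff k n]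
      (∀ A : {A : Finset (Fin n) // A.card = j},
        Fin (m A.1) → localCoh k n (Poly k n) A.1 A.1.card))

end Diff

end VarZero

end

noncomputable section

namespace VarZero

/-! ### Divided power differential operators -/

section Operators

variable {k : Type u} [Field k] {n : ℕ}

/-! The degree-`p` terms are matched vertex by vertex through `Hom_D(M, E_A) ≅ Hom_D(M_{x^{1-A}},
E_A) ≅ Hom_D(M_{x^{1-A}}, E_1)` (`vertexEquiv`). The first isomorphism is the universal property of
localization: the variables outside `A` act bijectively on `E_A` (`isLocal_inj`).

The second is composition with `E_A → E_1`. It is injective because the kernel of this epimorphism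
is filtered by images of the `R_{x^{1-ε_i}}`, `i ∉ A`, on which `∂ᵢ` acts locally nilpotently, while
`xᵢ` is surjective on `M_{x^{1-A}}` (`eq_zero_of_injMap_comp_eq_zero`). Surjectivity uses variation
zero: after inverting the variables outside `A`, the layers of dimension type `|α| > |A|` die, those
with `|α| < |A|` have no torsion subquotients, and the layer `|α| = |A|` becomes a power of `E_A`
(`exists_loc_to_inj`). As `E_1` is torsion, a map `M_{x^{1-A}} → E_1` factors through this power.
Its components `E_A → E_1` are scalar multiples of the canonical map (`exists_eq_smul_mkQ`), since
`E_1` is simple with socle spanned by `1/(x₁⋯xₙ)`. Hence the map lifts to `E_A`.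

These isomorphisms are natural in `A` (`vertexEquiv_naturality`), and the signs `compSign` reconcile
the two orientations, which gives the isomorphism of complexes.

For homology, `Hom_D(-, E_1)` behaves exactly on the Čech complex: each term maps to a power of
`E_1`, a semisimple module, with a kernel free of torsion subquotients, so maps to `E_1` extend from
submodules (`extendsToInj_cech`). All arguments with `∂ᵢ` use divided powers and so hold in every
characteristic. -/

open MvPolynomial in
/-- The divided power operator `(1/s!) ∂ᵢˢ` as a `k`-linear map. -/
def dividedPow (i : Fin n) (s : ℕ) : Module.End k (Poly k n) :=
  (basisMonomials (Fin n) k).constr k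
    (fun b => monomial (b - Finsupp.single i s) ((b i).choose s : k))

open MvPolynomial in
lemma dividedPow_monomial (i : Fin n) (s : ℕ) (b : Fin n →₀ ℕ) (c : k) :
    dividedPow i s (monomial b c) = monomial (b - Finsupp.single i s) (c * (b i).choose s) := by
  have h : monomial b c = c • basisMonomials (Fin n) k b := by
    simp [smul_monomial]
  rw [h, map_smul, dividedPow, Module.Basis.constr_basis, smul_monomial, smul_eq_mul]

open MvPolynomial in
lemma dividedPow_zero (i : Fin n) : dividedPow (k := k) i 0 = 1 := by
  refine LinearMap.ext fun p => ?_
  induction p using MvPolynomial.induction_on' with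
  | monomial b c => simp [dividedPow_monomial]
  | add p q hp hq => simpa using congrArg₂ (· + ·) hp hq

-- On coefficients this is Pascal's rule. The relation `[∂ᵢ^{[s+1]}, xᵢ] = ∂ᵢ^{[s]}` drives every
-- later argument on torsion and nilpotency.
open MvPolynomial in
lemma dividedPow_mulLeft_self (i : Fin n) (s : ℕ) :
    dividedPow (k := k) i (s + 1) * LinearMap.mulLeft k (X i) =
      LinearMap.mulLeft k (X i) * dividedPow i (s + 1) + dividedPow i s := by
  refine LinearMap.ext fun p => ?_
  induction p using MvPolynomial.induction_on' with
  | monomial b c =>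
    simp only [Module.End.mul_apply, LinearMap.mulLeft_apply, LinearMap.add_apply,
      dividedPow_monomial, X, monomial_mul, one_mul]
    have e1 : Finsupp.single i 1 + b - Finsupp.single i (s + 1) = b - Finsupp.single i s := by
      ext j; simp only [Finsupp.coe_tsub, Finsupp.coe_add, Pi.sub_apply, Pi.add_apply]
      by_cases h : j = i
      · subst h; simp; omega
      · simp [Ne.symm h]
    rw [e1]
    have e2 : (Finsupp.single i 1 + b : Fin n →₀ ℕ) i = b i + 1 := by simp [add_comm]
    rw [e2, Nat.choose_succ_succ]
    by_cases hb : s + 1 ≤ b i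
    · have e3 : Finsupp.single i 1 + (b - Finsupp.single i (s + 1)) = b - Finsupp.single i s := by
        ext j; simp only [Finsupp.coe_tsub, Finsupp.coe_add, Pi.sub_apply, Pi.add_apply]
        by_cases h : j = i
        · subst h; simp; omega
        · simp [Ne.symm h]
      rw [e3, ← map_add]
      congr 1
      push_cast; ring
    -- Here truncated subtraction makes the exponents disagree, but the coefficient concerned is
    -- zero.
    · rw [Nat.choose_eq_zero_of_lt (not_le.mp hb)]
      simp
  | add p q hp hq => rw [map_add, map_add, hp, hq]

open MvPolynomial in
lemma dividedPow_mulLeft_of_ne {i j : Fin n} (hij : j ≠ i) (s : ℕ) :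
    dividedPow (k := k) i s * LinearMap.mulLeft k (X j) =
      LinearMap.mulLeft k (X j) * dividedPow i s := by
  refine LinearMap.ext fun p => ?_
  induction p using MvPolynomial.induction_on' with
  | monomial b c =>
    simp only [Module.End.mul_apply, LinearMap.mulLeft_apply,
      dividedPow_monomial, X, monomial_mul, one_mul]
    have e2 : (Finsupp.single j 1 + b : Fin n →₀ ℕ) i = b i := by simp [hij]
    rw [e2]
    congr 2
    ext l; simp only [Finsupp.coe_tsub, Finsupp.coe_add, Pi.sub_apply, Pi.add_apply]
    by_cases h : l = i
    · subst h; simp [hij]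
    · simp [Ne.symm h]
  | add p q hp hq => simpa [mul_add] using congrArg₂ (· + ·) hp hq

/-- The order of a differential operator on a polynomial ring can be tested on variables. -/
lemma isDiffOp_commutator_of_X {d : ℕ} {P : Module.End k (Poly k n)}
    (h : ∀ j, IsDiffOp k (Poly k n) d (P * LinearMap.mulLeft k (MvPolynomial.X j) -
      LinearMap.mulLeft k (MvPolynomial.X j) * P)) (a : Poly k n) :
    IsDiffOp k (Poly k n) d (P * LinearMap.mulLeft k a - LinearMap.mulLeft k a * P) := by
  induction a using MvPolynomial.induction_on with
  | C c =>
    have : P * LinearMap.mulLeft k (MvPolynomial.C c) -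
        LinearMap.mulLeft k (MvPolynomial.C c) * P = 0 := by
      refine LinearMap.ext fun p => ?_
      simp only [LinearMap.sub_apply, Module.End.mul_apply, LinearMap.mulLeft_apply,
        MvPolynomial.C_mul', map_smul, sub_self, LinearMap.zero_apply]
    rw [this]; exact IsDiffOp.zero d
  | add p q hp hq =>
    have : P * LinearMap.mulLeft k (p + q) - LinearMap.mulLeft k (p + q) * P =
        (P * LinearMap.mulLeft k p - LinearMap.mulLeft k p * P) +
        (P * LinearMap.mulLeft k q - LinearMap.mulLeft k q * P) := by
      refine LinearMap.ext fun r => ?_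
      simp [add_mul]; ring
    rw [this]; exact hp.add hq
  | mul_X p j hp =>
    have : P * LinearMap.mulLeft k (p * MvPolynomial.X j) -
          LinearMap.mulLeft k (p * MvPolynomial.X j) * P =
        (P * LinearMap.mulLeft k p - LinearMap.mulLeft k p * P) *
          LinearMap.mulLeft k (MvPolynomial.X j) +
        LinearMap.mulLeft k p * (P * LinearMap.mulLeft k (MvPolynomial.X j) -
          LinearMap.mulLeft k (MvPolynomial.X j) * P) := by
      refine LinearMap.ext fun r => ?_
      simp [mul_sub]
    rw [this]
    refine IsDiffOp.add ?_ ?_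
    · simpa using hp.mul (isDiffOp_mulLeft _)
    · simpa using (isDiffOp_mulLeft p).mul (h j)

/-- The commutator with `xᵢ` is the preceding divided power and the commutators with the other
variables vanish. -/
lemma isDiffOp_dividedPow (i : Fin n) (s : ℕ) : IsDiffOp k (Poly k n) s (dividedPow i s) := by
  induction s with
  | zero => intro a; rw [dividedPow_zero, one_mul, mul_one, sub_self]
  | succ s ih =>
    refine isDiffOp_commutator_of_X fun j => ?_
    by_cases hij : j = i
    · subst hij
      rw [dividedPow_mulLeft_self, add_sub_cancel_left]
      exact ih
    · rw [dividedPow_mulLeft_of_ne hij, sub_self]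
      exact IsDiffOp.zero s

/-- The variable `xᵢ` in `D`. -/
def xop (i : Fin n) : Diff k n := mul k n (MvPolynomial.X i)

/-- The divided power `(1/s!) ∂ᵢˢ` in `D`. -/
def dop (i : Fin n) (s : ℕ) : Diff k n :=
  (⟨dividedPow i s, s, isDiffOp_dividedPow i s⟩ : diffOps k (Poly k n))

lemma dop_zero (i : Fin n) : dop (k := k) i 0 = 1 :=
  Subtype.ext (dividedPow_zero i)

lemma dop_mul_xop_self (i : Fin n) (s : ℕ) :
    dop (k := k) i (s + 1) * xop i = xop i * dop i (s + 1) + dop i s :=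
  Subtype.ext (dividedPow_mulLeft_self i s)

lemma dop_mul_xop_of_ne {i j : Fin n} (hij : j ≠ i) (s : ℕ) :
    dop (k := k) i s * xop j = xop j * dop i s :=
  Subtype.ext (dividedPow_mulLeft_of_ne hij s)

lemma mul_smul_poly (a p : Poly k n) : mul k n a • p = a * p := rfl

lemma dop_smul_poly (i : Fin n) (s : ℕ) (p : Poly k n) :
    dop (k := k) i s • p = dividedPow i s p := rfl

lemma mul_comm' (a b : Poly k n) : mul k n a * mul k n b = mul k n b * mul k n a :=
  ((mul k n).map_mul a b).symm.trans ((congrArg (mul k n) (mul_comm a b)).trans ((mul k n).map_mul b a))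

lemma xop_mem_monoms {i : Fin n} {A : Finset (Fin n)} (h : i ∈ A) : xop (k := k) i ∈ monoms k n A :=
  ⟨_, Submonoid.subset_closure ⟨i, h, rfl⟩, rfl⟩

lemma monoms_induction {A : Finset (Fin n)} {p : Diff k n → Prop} (one : p 1)
    (mul_xop : ∀ s, s ∈ monoms k n A → p s → ∀ i ∈ A, p (s * xop i)) (s : Diff k n)
    (hs : s ∈ monoms k n A) : p s := by
  obtain ⟨r, hr, rfl⟩ := hs
  change p (mul k n r)
  refine Submonoid.closure_induction_right (motive := fun r _ => p (mul k n r)) ?_ ?_ hr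
  · rwa [map_one]
  · rintro r hr _ ⟨i, hi, rfl⟩ h
    rw [map_mul]
    exact mul_xop _ ⟨r, hr, rfl⟩ h i hi

lemma monoms_comm {A B : Finset (Fin n)} {s t : Diff k n} (hs : s ∈ monoms k n A)
    (ht : t ∈ monoms k n B) : s * t = t * s := by
  obtain ⟨r, hr, rfl⟩ := hs
  obtain ⟨r', hr', rfl⟩ := ht
  exact mul_comm' r r'

lemma dop_monoms_comm {A : Finset (Fin n)} {i : Fin n} (hi : i ∉ A) (m : ℕ) {s : Diff k n}
    (hs : s ∈ monoms k n A) : dop i m * s = s * dop i m := by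
  refine monoms_induction (A := A) (p := fun s => dop i m * s = s * dop i m) ?_ ?_ s hs
  · simp
  · intro s _ h j hj
    rw [← mul_assoc, h, mul_assoc, dop_mul_xop_of_ne (by rintro rfl; exact hi hj), mul_assoc]

lemma monoms_ore {A : Finset (Fin n)} (P : Diff k n) {s : Diff k n} (hs : s ∈ monoms k n A) :
    ∃ t ∈ monoms k n A, ∃ Q : Diff k n, t * P = Q * s := by
  obtain ⟨r, t, h⟩ := OreLocalization.oreCondition P (⟨s, hs⟩ : monoms k n A)
  exact ⟨t, t.2, r, h⟩

lemma monoms_union {A B : Finset (Fin n)} {s : Diff k n} (hs : s ∈ monoms k n (A ∪ B)) :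
    ∃ a ∈ monoms k n A, ∃ b ∈ monoms k n B, s = a * b := by
  refine monoms_induction (A := A ∪ B) (p := fun s => ∃ a ∈ monoms k n A, ∃ b ∈ monoms k n B, s = a * b)
    ⟨1, one_mem _, 1, one_mem _, (mul_one 1).symm⟩ ?_ s hs
  rintro s - ⟨a, ha, b, hb, rfl⟩ i hi
  rcases Finset.mem_union.mp hi with h | h
  · refine ⟨a * xop i, mul_mem ha (xop_mem_monoms h), b, hb, ?_⟩
    rw [mul_assoc, mul_assoc, monoms_comm hb (xop_mem_monoms h)]
  · exact ⟨a, ha, b * xop i, mul_mem hb (xop_mem_monoms h), mul_assoc _ _ _⟩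

/-- Allows any monomial denominator to be replaced by a power of the product of the variables. -/
lemma monoms_dvd_pow {A : Finset (Fin n)} {s : Diff k n} (hs : s ∈ monoms k n A) :
    ∃ (N : ℕ), ∃ t ∈ monoms k n A,
      t * s = mul k n (∏ i ∈ A, MvPolynomial.X i) ^ N := by
  refine monoms_induction (A := A) (p := fun s => ∃ N : ℕ, ∃ t ∈ monoms k n A,
    t * s = mul k n (∏ i ∈ A, MvPolynomial.X i) ^ N) ⟨0, 1, one_mem _, by simp⟩ ?_ s hs
  rintro s hs ⟨N, t, ht, h⟩ i hi
  have hp : mul k n (∏ j ∈ A.erase i, MvPolynomial.X j) ∈ monoms k n A :=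
    ⟨_, prod_mem fun j hj => Submonoid.subset_closure ⟨j, Finset.mem_of_mem_erase hj, rfl⟩, rfl⟩
  refine ⟨N + 1, t * mul k n (∏ j ∈ A.erase i, MvPolynomial.X j), mul_mem ht hp, ?_⟩
  rw [← mul_assoc, mul_assoc t, monoms_comm hp hs, ← mul_assoc, h, mul_assoc, pow_succ, xop,
    ← map_mul, Finset.prod_erase_mul _ _ hi]

end Operators

/-! ### Saturation of submodules and localization -/

section Saturation

variable {k : Type u} [Field k] {n : ℕ} {M : Type*} [AddCommGroup M] [Module (Diff k n) M]
  {N : Type*} [AddCommGroup N] [Module (Diff k n) N]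

/-- The saturation of a submodule with respect to the monomials in `xᵢ`, `i ∈ A`. -/
def sat (A : Finset (Fin n)) (U : Submodule (Diff k n) M) : Submodule (Diff k n) M where
  carrier := {y | ∃ s ∈ monoms k n A, s • y ∈ U}
  add_mem' := by
    rintro y z ⟨s, hs, hy⟩ ⟨t, ht, hz⟩
    refine ⟨s * t, mul_mem hs ht, ?_⟩
    rw [smul_add]
    refine add_mem ?_ ?_
    · rw [monoms_comm hs ht, mul_smul]; exact U.smul_mem t hy
    · rw [mul_smul]; exact U.smul_mem s hz
  zero_mem' := ⟨1, one_mem _, by simp⟩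
  smul_mem' := by
    rintro P y ⟨s, hs, hy⟩
    obtain ⟨t, ht, Q, h⟩ := monoms_ore P hs
    refine ⟨t, ht, ?_⟩
    rw [← mul_smul, h, mul_smul]
    exact U.smul_mem Q hy

lemma le_sat (A : Finset (Fin n)) (U : Submodule (Diff k n) M) : U ≤ sat A U :=
  fun y hy => ⟨1, one_mem _, by simpa using hy⟩

lemma sat_mono (A : Finset (Fin n)) : Monotone (sat (M := M) (k := k) A) :=
  fun _ _ h _ ⟨s, hs, hy⟩ => ⟨s, hs, h hy⟩

lemma sat_sat_union (A B : Finset (Fin n)) (U : Submodule (Diff k n) M) :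
    sat B (sat A U) = sat (A ∪ B) U := by
  ext y
  constructor
  · rintro ⟨b, hb, a, ha, h⟩
    refine ⟨a * b, mul_mem (monoms_mono k n Finset.subset_union_left ha)
      (monoms_mono k n Finset.subset_union_right hb), by rwa [mul_smul]⟩
  · rintro ⟨s, hs, h⟩
    obtain ⟨a, ha, b, hb, rfl⟩ := monoms_union hs
    exact ⟨b, hb, a, ha, by rwa [mul_smul] at h⟩

/-- The monomials in `xᵢ`, `i ∈ A`, act bijectively. -/
def IsLocal (k : Type u) [Field k] {n : ℕ} (A : Finset (Fin n)) (N : Type*) [AddCommGroup N]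
    [Module (Diff k n) N] : Prop :=
  ∀ s ∈ monoms k n A, Function.Bijective (fun y : N => s • y)

lemma IsLocal.smul_cancel {A : Finset (Fin n)} (h : IsLocal k A N) {s : Diff k n}
    (hs : s ∈ monoms k n A) {y z : N} (e : s • y = s • z) : y = z := (h s hs).1 e

lemma IsLocal.mono {A B : Finset (Fin n)} (hAB : A ⊆ B) (h : IsLocal k B N) : IsLocal k A N :=
  fun s hs => h s (monoms_mono k n hAB hs)

lemma IsLocal.sat_bot {A : Finset (Fin n)} (h : IsLocal k A N) :
    sat A (⊥ : Submodule (Diff k n) N) = ⊥ := by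
  refine le_bot_iff.mp ?_
  rintro y ⟨s, hs, hy⟩
  exact h.smul_cancel hs (by rw [(Submodule.mem_bot _).mp hy, smul_zero])

lemma IsLocal.pi {A : Finset (Fin n)} {ι : Type*} (h : IsLocal k A N) : IsLocal k A (ι → N) := by
  intro s hs
  constructor
  · intro y z e
    exact funext fun l => (h s hs).1 (congrFun e l)
  · intro y
    choose z hz using fun l => (h s hs).2 (y l)
    exact ⟨z, funext hz⟩

lemma sat_sup {A : Finset (Fin n)} (h : IsLocal k A N) (U V : Submodule (Diff k n) N) :
    sat A (U ⊔ V) = sat A U ⊔ sat A V := by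
  refine le_antisymm ?_ (sup_le (sat_mono A le_sup_left) (sat_mono A le_sup_right))
  rintro y ⟨s, hs, hy⟩
  obtain ⟨u, hu, w, hw, e⟩ := Submodule.mem_sup.mp hy
  obtain ⟨u', rfl⟩ := (h s hs).2 u
  obtain ⟨w', rfl⟩ := (h s hs).2 w
  refine Submodule.mem_sup.mpr ⟨u', ⟨s, hs, hu⟩, w', ⟨s, hs, hw⟩, ?_⟩
  exact h.smul_cancel hs (by simpa using e)

/-- `f` exhibits `N` as the localization of `M` at the monomials in `xᵢ`, `i ∈ A`. -/
structure IsLoc (A : Finset (Fin n)) (f : M →ₗ[Diff k n] N) : Prop where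
  isLocal : IsLocal k A N
  surj : ∀ y : N, ∃ s ∈ monoms k n A, ∃ m, s • y = f m
  ker : ∀ m, f m = 0 → ∃ s ∈ monoms k n A, s • m = 0

variable {P : Type*} [AddCommGroup P] [Module (Diff k n) P]

lemma IsLoc.hom_ext {A : Finset (Fin n)} {f : M →ₗ[Diff k n] N} (hf : IsLoc A f)
    (hP : IsLocal k A P) {g h : N →ₗ[Diff k n] P} (e : ∀ m, g (f m) = h (f m)) : g = h := by
  ext y
  obtain ⟨s, hs, m, hm⟩ := hf.surj y
  refine hP.smul_cancel hs ?_
  rw [← map_smul, ← map_smul, hm, e]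

lemma IsLoc.exists_lift {A : Finset (Fin n)} {f : M →ₗ[Diff k n] N} (hf : IsLoc A f)
    (hP : IsLocal k A P) (g : M →ₗ[Diff k n] P) :
    ∃ h : N →ₗ[Diff k n] P, ∀ m, h (f m) = g m := by
  -- The value `z` at `y` is determined by `s • z = g m` whenever `s • y = f m`. It does not depend
  -- on `(s, m)`: the difference `s' • m - s • m'` lies in the kernel of `f`, so a monomial kills
  -- it, and monomials act injectively on `P`.
  have ex : ∀ y : N, ∃ z : P, ∀ s ∈ monoms k n A, ∀ m, s • y = f m → s • z = g m := by
    intro y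
    obtain ⟨s, hs, m, hm⟩ := hf.surj y
    obtain ⟨z, hz⟩ := (hP s hs).2 (g m)
    refine ⟨z, fun s' hs' m' hm' => ?_⟩
    obtain ⟨t, ht, h0⟩ := hf.ker (s' • m - s • m') (by
      rw [map_sub, map_smul, map_smul, ← hm, ← hm', ← mul_smul, ← mul_smul, monoms_comm hs hs',
        sub_self])
    have h1 : t • (s' • g m - s • g m') = 0 := by
      rw [← map_smul, ← map_smul, ← map_sub, ← map_smul, h0, map_zero]
    have h2 : s' • g m = s • g m' := by
      refine hP.smul_cancel ht ?_
      rwa [smul_sub, sub_eq_zero] at h1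
    refine hP.smul_cancel hs ?_
    dsimp only at hz
    rw [← h2, ← hz, ← mul_smul, ← mul_smul, monoms_comm hs hs']
  choose φ hφ using ex
  have key : ∀ y z, (∃ s ∈ monoms k n A, ∃ m, s • y = f m ∧ s • z = g m) → φ y = z := by
    rintro y z ⟨s, hs, m, h1, h2⟩
    exact hP.smul_cancel hs ((hφ y s hs m h1).trans h2.symm)
  refine ⟨{ toFun := φ, map_add' := ?_, map_smul' := ?_ }, ?_⟩
  · intro y z
    obtain ⟨s, hs, m, hm⟩ := hf.surj y
    obtain ⟨t, ht, l, hl⟩ := hf.surj z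
    refine key _ _ ⟨s * t, mul_mem hs ht, t • m + s • l, ?_, ?_⟩
    · rw [smul_add, map_add, map_smul, map_smul, ← hm, ← hl, ← mul_smul, ← mul_smul,
        monoms_comm hs ht]
    · rw [smul_add, map_add, map_smul, map_smul, ← hφ y s hs m hm, ← hφ z t ht l hl, ← mul_smul,
        ← mul_smul, monoms_comm hs ht]
  · intro Q y
    obtain ⟨s, hs, m, hm⟩ := hf.surj y
    obtain ⟨t, ht, Q', h⟩ := monoms_ore Q hs
    refine key _ _ ⟨t, ht, Q' • m, ?_, ?_⟩
    · rw [← mul_smul, h, mul_smul, hm, map_smul]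
    · rw [RingHom.id_apply, ← mul_smul, h, mul_smul, hφ y s hs m hm, map_smul]
  · intro m
    exact key _ _ ⟨1, one_mem _, m, by simp, by simp⟩

end Saturation

/-! ### The canonical maps to the localizations -/

section Loc

variable (k : Type u) [Field k] (n : ℕ) (M : Type v) [AddCommGroup M] [Module (Diff k n) M]

/-- The canonical map `M → M_{x^A}`. -/
def locMap (A : Finset (Fin n)) : M →ₗ[Diff k n] Loc k n M A where
  toFun m := OreLocalization.oreDiv m 1
  map_add' _ _ := OreLocalization.add_oreDiv.symm
  map_smul' P m := (OreLocalization.smul_oreDiv_one P m).symm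

variable {k n M}

lemma smul_oreDiv_self {A : Finset (Fin n)} (m : M) (s : monoms k n A) :
    (s : Diff k n) • (OreLocalization.oreDiv m s : Loc k n M A) = locMap k n M A m := by
  rw [← OreLocalization.oreDiv_one_smul]
  exact OreLocalization.smul_cancel

lemma isLoc_locMap (A : Finset (Fin n)) : IsLoc A (locMap k n M A) where
  isLocal s hs := by
    constructor
    · intro y z e
      have h : ∀ y : Loc k n M A,
          (OreLocalization.oreDiv 1 ⟨s, hs⟩ : Loc k n (Diff k n) A) • (s • y) = y := by
        intro y
        rw [← OreLocalization.oreDiv_one_smul s y, ← mul_smul]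
        have := OreLocalization.mul_inv (1 : monoms k n A) ⟨s, hs⟩
        simp only [OneMemClass.coe_one] at this
        rw [this, one_smul]
      rw [← h y, ← h z]
      exact congrArg _ e
    · intro y
      induction y using OreLocalization.ind with | _ m t
      refine ⟨OreLocalization.oreDiv m (t * ⟨s, hs⟩), ?_⟩
      have h := OreLocalization.one_div_smul (r := m) (s := t) (t := ⟨s, hs⟩)
      dsimp only
      rw [← h, ← OreLocalization.oreDiv_one_smul s, ← mul_smul]
      have := OreLocalization.mul_inv (⟨s, hs⟩ : monoms k n A) 1
      simp only [OneMemClass.coe_one] at this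
      rw [this, one_smul]
  surj y := by
    induction y using OreLocalization.ind with | _ m t
    exact ⟨t, t.2, m, smul_oreDiv_self m t⟩
  ker m h := by
    change OreLocalization.oreDiv m 1 = 0 at h
    rw [OreLocalization.zero_def, OreLocalization.oreDiv_eq_iff] at h
    obtain ⟨u, w, h1, h2⟩ := h
    refine ⟨u, u.2, ?_⟩
    simp only [smul_zero, OneMemClass.coe_one, mul_one] at h1 h2
    rw [h2, ← h1]

lemma oreMap_locMap {A B : Finset (Fin n)} (h : A ⊆ B) (m : M) :
    oreMap M (monoms_mono k n h) (locMap k n M A m) = locMap k n M B m := rfl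

end Loc

/-! ### Subquotients without torsion -/

section Torsion

variable {k : Type u} [Field k] {n : ℕ} {N : Type*} [AddCommGroup N] [Module (Diff k n) N]
  {P : Type*} [AddCommGroup P] [Module (Diff k n) P]

/-- Modulo `F`, every element of `U` is killed by almost all divided powers of `∂ᵢ`. -/
def DNilp (i : Fin n) (F U : Submodule (Diff k n) N) : Prop :=
  ∀ y ∈ U, ∃ b : ℕ, ∀ s ≥ b, dop (k := k) i s • y ∈ F

/-- The quotient of `U` by `F` has no nonzero subquotient killed by a power of `𝔪`; only
elements of the socle have to be considered. -/
def SocleFree (F U : Submodule (Diff k n) N) : Prop :=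
  ∀ B, F ≤ B → ∀ a ∈ U, (∀ i : Fin n, xop (k := k) i • a ∈ B) → a ∈ B

/-- Descending induction on `s`: if `xᵢ a` and `∂ᵢ^{[s+1]} a` lie in `B`, so does `∂ᵢ^{[s]} a =
∂ᵢ^{[s+1]} xᵢ a - xᵢ ∂ᵢ^{[s+1]} a`. At `s = 0` the operator is the identity. -/
lemma DNilp.mem_of_xop_smul_mem {i : Fin n} {F U B : Submodule (Diff k n) N} (h : DNilp i F U)
    (hB : F ≤ B) {a : N} (ha : a ∈ U) (hx : xop (k := k) i • a ∈ B) : a ∈ B := by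
  obtain ⟨b, hb⟩ := h a ha
  have key : ∀ b : ℕ, (∀ s ≥ b, dop (k := k) i s • a ∈ B) → a ∈ B := by
    intro b
    induction b with
    | zero => exact fun h => by simpa [dop_zero] using h 0 le_rfl
    | succ b ih =>
      refine fun h => ih fun s hs => ?_
      rcases hs.eq_or_lt with rfl | hs
      · have := B.smul_mem (dop i (b + 1)) hx
        rw [← mul_smul, dop_mul_xop_self, add_smul, mul_smul] at this
        exact (B.add_mem_iff_right (B.smul_mem _ (h (b + 1) le_rfl))).mp this
      · exact h s hs
  exact key b fun s hs => hB (hb s hs)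

lemma DNilp.socleFree {i : Fin n} {F U : Submodule (Diff k n) N} (h : DNilp i F U) :
    SocleFree F U := fun _ hB _ ha hx => h.mem_of_xop_smul_mem hB ha (hx i)

lemma DNilp.mono {i : Fin n} {F F' U U' : Submodule (Diff k n) N} (h : DNilp i F U)
    (hF : F ≤ F') (hU : U' ≤ U) : DNilp i F' U' := fun y hy =>
  let ⟨b, hb⟩ := h y (hU hy)
  ⟨b, fun s hs => hF (hb s hs)⟩

lemma DNilp.map {i : Fin n} {F U : Submodule (Diff k n) N} (h : DNilp i F U)
    (f : N →ₗ[Diff k n] P) : DNilp i (F.map f) (U.map f) := by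
  rintro _ ⟨y, hy, rfl⟩
  obtain ⟨b, hb⟩ := h y hy
  exact ⟨b, fun s hs => ⟨_, hb s hs, map_smul f _ _⟩⟩

/-- The operators `∂ᵢ^{[s]}` commute with monomials that do not involve `xᵢ`. -/
lemma DNilp.sat {i : Fin n} {F U : Submodule (Diff k n) N} (h : DNilp i F U)
    {A : Finset (Fin n)} (hi : i ∉ A) : DNilp i (sat A F) (sat A U) := by
  rintro y ⟨t, ht, hy⟩
  obtain ⟨b, hb⟩ := h _ hy
  refine ⟨b, fun s hs => ⟨t, ht, ?_⟩⟩
  rw [← mul_smul, ← dop_monoms_comm hi s ht, mul_smul]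
  exact hb s hs

lemma SocleFree.mono {F F' U U' : Submodule (Diff k n) N} (h : SocleFree F U)
    (hF : F ≤ F') (hU : U' ≤ U) : SocleFree F' U' :=
  fun B hB a ha hx => h B (hF.trans hB) a (hU ha) hx

lemma SocleFree.bot (F : Submodule (Diff k n) N) : SocleFree F ⊥ := by
  intro B _ a ha _
  rw [(Submodule.mem_bot _).mp ha]
  exact B.zero_mem

/-- Enlarging `B` to `B ⊔ G` shows that `a` is congruent modulo `B` to an element of `G`, to which
the first hypothesis applies. -/
lemma SocleFree.trans {F G U : Submodule (Diff k n) N} (h : SocleFree F G)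
    (h' : SocleFree G U) : SocleFree F U := by
  intro B hB a ha hx
  obtain ⟨b, hb, g, hg, rfl⟩ := Submodule.mem_sup.mp
    (h' (B ⊔ G) le_sup_right a ha fun i => (le_sup_left : B ≤ B ⊔ G) (hx i))
  refine B.add_mem hb (h B hB g hg fun i => ?_)
  have := B.sub_mem (hx i) (B.smul_mem (xop i) hb)
  rwa [smul_add, add_sub_cancel_left] at this

lemma SocleFree.sup {F U V : Submodule (Diff k n) N} (h : SocleFree F U)
    (h' : SocleFree F V) : SocleFree F (U ⊔ V) := by
  intro B hB a ha hx
  have hV : a ∈ B ⊔ U := by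
    obtain ⟨w, hw, z, hz, rfl⟩ := Submodule.mem_sup.mp ha
    have hw' : w ∈ B ⊔ U := (le_sup_right : U ≤ B ⊔ U) hw
    refine add_mem hw' (h' (B ⊔ U) (hB.trans le_sup_left) z hz fun i => ?_)
    have := sub_mem ((le_sup_left : B ≤ B ⊔ U) (hx i)) ((B ⊔ U).smul_mem (xop i) hw')
    rwa [smul_add, add_sub_cancel_left] at this
  obtain ⟨b, hb, g, hg, rfl⟩ := Submodule.mem_sup.mp hV
  refine B.add_mem hb (h B hB g hg fun i => ?_)
  have := B.sub_mem (hx i) (B.smul_mem (xop i) hb)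
  rwa [smul_add, add_sub_cancel_left] at this

lemma SocleFree.finset_sup {F : Submodule (Diff k n) N} {ι : Type*} (A : Finset ι)
    {U : ι → Submodule (Diff k n) N} (h : ∀ c ∈ A, SocleFree F (U c)) : SocleFree F (A.sup U) :=
  Finset.sup_induction (SocleFree.bot F) (fun _ h _ h' => h.sup h') h

lemma SocleFree.iSup {F : Submodule (Diff k n) N} {ι : Type*} [Fintype ι]
    {U : ι → Submodule (Diff k n) N} (h : ∀ c, SocleFree F (U c)) : SocleFree F (⨆ c, U c) := by
  rw [← Finset.sup_univ_eq_iSup]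
  exact SocleFree.finset_sup _ fun c _ => h c

lemma SocleFree.map {F U : Submodule (Diff k n) N} (h : SocleFree F U) (f : N →ₗ[Diff k n] P) :
    SocleFree (F.map f) (U.map f) := by
  rintro B hB _ ⟨a, ha, rfl⟩ hx
  refine h (B.comap f) (Submodule.map_le_iff_le_comap.mp hB) a ha fun i => ?_
  rw [Submodule.mem_comap, map_smul]
  exact hx i

lemma SocleFree.comap {F U : Submodule (Diff k n) P} (h : SocleFree F U)
    {f : N →ₗ[Diff k n] P} (hf : Function.Surjective f) :
    SocleFree (F.comap f) (U.comap f) := by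
  intro B hB a ha hx
  have hF : F ≤ B.map f := by
    intro y hy
    obtain ⟨z, rfl⟩ := hf y
    exact ⟨z, hB hy, rfl⟩
  obtain ⟨b, hb, e⟩ := h (B.map f) hF (f a) ha fun i => ⟨_, hx i, map_smul f _ _⟩
  have : a - b ∈ B := hB (by
    rw [Submodule.mem_comap, map_sub, e, sub_self]
    exact F.zero_mem)
  simpa using B.add_mem this hb

lemma xop_pow_comm (i j : Fin n) (t : ℕ) :
    xop (k := k) i * xop j ^ t = xop j ^ t * xop i :=
  Commute.pow_right (mul_comm' _ _) t

lemma xop_pow_pow_comm (i j : Fin n) (s t : ℕ) :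
    xop (k := k) i ^ s * xop j ^ t = xop j ^ t * xop i ^ s :=
  Commute.pow_pow (mul_comm' _ _) s t

/-- Passes from the socle to elements killed by powers of the variables. The induction is on the set
`S` of variables not yet known to send `a` into `B`, and inside it on the exponent for one variable
of `S`. -/
lemma mem_of_forall_xop_pow_smul_mem {B U : Submodule (Diff k n) N}
    (h : ∀ a ∈ U, (∀ i : Fin n, xop (k := k) i • a ∈ B) → a ∈ B) {a : N} (ha : a ∈ U)
    (ht : ∀ i : Fin n, ∃ t : ℕ, xop (k := k) i ^ t • a ∈ B) : a ∈ B := by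
  have key : ∀ S : Finset (Fin n), ∀ a ∈ U, (∀ i : Fin n, ∃ t : ℕ, xop (k := k) i ^ t • a ∈ B) →
      (∀ i ∉ S, xop (k := k) i • a ∈ B) → a ∈ B := by
    intro S
    induction S using Finset.induction_on with
    | empty => exact fun a ha _ hx => h a ha fun i => hx i (Finset.notMem_empty i)
    | insert i S _ ih =>
      intro a ha hT hx
      obtain ⟨t, ht⟩ := hT i
      induction t with
      | zero => simpa using ht
      | succ t iht =>
        refine iht (ih _ (U.smul_mem _ ha) (fun j => ?_) fun j hj => ?_)
        · obtain ⟨r, hr⟩ := hT j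
          refine ⟨r, ?_⟩
          rw [← mul_smul, xop_pow_pow_comm, mul_smul]
          exact B.smul_mem _ hr
        · by_cases hij : j = i
          · subst hij
            rw [← mul_smul, ← pow_succ']
            exact ht
          · rw [← mul_smul, xop_pow_comm, mul_smul]
            exact B.smul_mem _ (hx j (by simp [hij, hj]))
  exact key Finset.univ a ha ht fun i hi => absurd (Finset.mem_univ i) hi

/-- Every element is killed by a power of each variable. -/
def IsTorsion (k : Type u) [Field k] (n : ℕ) (N : Type*) [AddCommGroup N]
    [Module (Diff k n) N] : Prop :=
  ∀ (a : N) (i : Fin n), ∃ t : ℕ, xop (k := k) i ^ t • a = 0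

/-- The defining property with `B` the kernel of `f`: powers of each variable bring `a` into it, as
the target is torsion. -/
lemma SocleFree.map_eq_zero {F U : Submodule (Diff k n) N} (h : SocleFree F U)
    (hP : IsTorsion k n P) (f : N →ₗ[Diff k n] P) (hf : F ≤ LinearMap.ker f) {a : N}
    (ha : a ∈ U) : f a = 0 := by
  refine LinearMap.mem_ker.mp (mem_of_forall_xop_pow_smul_mem (h _ hf) ha fun i => ?_)
  obtain ⟨t, ht⟩ := hP (f a) i
  exact ⟨t, by rw [LinearMap.mem_ker, map_smul, ht]⟩

/-- When `xᵢ b = 0` the commutation relation reads `xᵢ ∂ᵢ^{[t+1]} b = -∂ᵢ^{[t]} b`; iterate. -/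
lemma xop_pow_smul_dop_smul {i : Fin n} {b : N} (hb : xop (k := k) i • b = 0) (t : ℕ) :
    xop (k := k) i ^ t • dop (k := k) i t • b = (-1 : ℤ) ^ t • b := by
  induction t with
  | zero => simp [dop_zero]
  | succ t ih =>
    have h : xop (k := k) i • dop (k := k) i (t + 1) • b = - (dop (k := k) i t • b) := by
      have := congrArg (fun Q : Diff k n => Q • b) (dop_mul_xop_self (k := k) i t)
      simp only [add_smul, mul_smul, hb, smul_zero] at this
      exact eq_neg_of_add_eq_zero_left this.symm
    rw [pow_succ, mul_smul, h, smul_neg, ih, pow_succ, mul_neg_one, neg_smul]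

/-- A torsion `D`-module is generated by its socle. -/
lemma mem_of_socle_le (hN : IsTorsion k n N) (Q : Submodule (Diff k n) N)
    (hQ : ∀ b, (∀ i : Fin n, xop (k := k) i • b = 0) → b ∈ Q) (a : N) : a ∈ Q := by
  have key : ∀ S : Finset (Fin n), ∀ a : N,
      (∀ i ∉ S, xop (k := k) i • a = 0) → a ∈ Q := by
    intro S
    induction S using Finset.induction_on with
    | empty => exact fun a hx => hQ a fun i => hx i (Finset.notMem_empty i)
    | insert i S _ ih =>
      intro a hx
      obtain ⟨t, ht⟩ := hN a i
      induction t generalizing a with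
      | zero =>
        rw [pow_zero, one_smul] at ht
        rw [ht]; exact Q.zero_mem
      | succ t iht =>
        have hxi : xop (k := k) i • xop (k := k) i ^ t • a = 0 := by
          rw [← mul_smul, ← pow_succ']; exact ht
        have hb : xop (k := k) i ^ t • a ∈ Q := by
          refine ih _ fun j hj => ?_
          by_cases hij : j = i
          · subst hij; exact hxi
          · rw [← mul_smul, xop_pow_comm, mul_smul, hx j (by simp [hij, hj]), smul_zero]
        -- This correction term lies in `Q` and has the same product with `xᵢ^t` as `a`, so
        -- subtracting it leaves an element killed by `xᵢ^t` and still by the variables outside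
        -- `insert i S`.
        have hd : (-1 : ℤ) ^ t • dop (k := k) i t • xop (k := k) i ^ t • a ∈ Q :=
          zsmul_mem (Q.smul_mem _ hb) _
        have := iht (a - (-1 : ℤ) ^ t • dop (k := k) i t • xop (k := k) i ^ t • a)
          (fun j hj => ?_) ?_
        · simpa using Q.add_mem this hd
        · have hij : j ≠ i := by rintro rfl; exact hj (Finset.mem_insert_self _ _)
          rw [smul_sub, hx j hj, smul_comm, ← mul_smul (xop j), ← dop_mul_xop_of_ne hij, mul_smul,
            ← mul_smul (xop j), xop_pow_comm, mul_smul, hx j hj]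
          simp
        · rw [smul_sub, smul_comm, xop_pow_smul_dop_smul hxi, smul_smul, ← mul_pow]
          simp
  exact key Finset.univ a fun i hi => absurd (Finset.mem_univ i) hi

/-- A map from a module on which `xᵢ` is surjective to a module on which almost all divided powers
of `∂ᵢ` vanish is zero. -/
lemma eq_zero_of_xop_surjective {i : Fin n} (f : N →ₗ[Diff k n] P)
    (hN : Function.Surjective (fun y : N => xop (k := k) i • y))
    (h : DNilp i ⊥ (LinearMap.range f)) : f = 0 := by
  have key : ∀ b : ℕ, ∀ a : N, (∀ s ≥ b, dop (k := k) i s • f a = 0) → f a = 0 := by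
    intro b
    induction b with
    | zero =>
      intro a ha
      simpa [dop_zero] using ha 0 le_rfl
    | succ b ih =>
      intro a ha
      -- Dividing `a` by `xᵢ` lowers the nilpotency bound by one: `f c` satisfies the bound `b`, so
      -- it vanishes by induction, and `f a = xᵢ f c`.
      obtain ⟨c, rfl⟩ := hN a
      have hr : ∀ s, dop (k := k) i (s + 1) • f (xop (k := k) i • c) =
          xop (k := k) i • dop (k := k) i (s + 1) • f c + dop (k := k) i s • f c := by
        intro s
        rw [map_smul, ← mul_smul, dop_mul_xop_self, add_smul, mul_smul]
      obtain ⟨d, hd⟩ := h (f c) ⟨c, rfl⟩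
      have hc : ∀ s ≥ b, dop (k := k) i s • f c = 0 := by
        -- Some large bound holds for `f c` by hypothesis; `hr` lowers it one step at a time to `b`.
        have down : ∀ e : ℕ, (∀ s ≥ b + e, dop (k := k) i s • f c = 0) →
            ∀ s ≥ b, dop (k := k) i s • f c = 0 := by
          intro e
          induction e with
          | zero => exact id
          | succ e ihe =>
            refine fun h => ihe fun s hs => ?_
            rcases hs.eq_or_lt with rfl | hs
            · have := hr (b + e)
              rwa [h (b + e + 1) le_rfl, ha (b + e + 1) (by omega), smul_zero, zero_add,
                eq_comm] at this
            · exact h s hs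
        exact down d fun s hs => (Submodule.mem_bot _).mp (hd s (by omega))
      change f (xop (k := k) i • c) = 0
      rw [map_smul, ih c hc, smul_zero]
  ext a
  obtain ⟨b, hb⟩ := h (f a) ⟨a, rfl⟩
  exact key b a fun s hs => (Submodule.mem_bot _).mp (hb s hs)

end Torsion

/-! ### The full localization of the polynomial ring -/

section RLoc

variable {k : Type u} [Field k] {n : ℕ}

/-- The inclusion `R → R_{x^1}`. -/
def polyToRLoc : Poly k n →ₗ[Diff k n] RLoc k n := locMap k n (Poly k n) Finset.univ

/-- The image of `R` in `R_{x^1}`. -/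
def polySub : Submodule (Diff k n) (RLoc k n) := LinearMap.range polyToRLoc

lemma isLoc_polyToRLoc : IsLoc (Finset.univ : Finset (Fin n)) (polyToRLoc (k := k) (n := n)) :=
  isLoc_locMap (k := k) (M := Poly k n) Finset.univ

lemma isLocal_rLoc (A : Finset (Fin n)) : IsLocal k A (RLoc k n) :=
  isLoc_polyToRLoc.isLocal.mono (Finset.subset_univ A)

/-- Realizes every `R_{x^A}` as a saturation inside the single module `R_{x^1}`, so that sums and
further localizations become computations with submodules. -/
lemma range_toRLoc (A : Finset (Fin n)) : LinearMap.range (toRLoc k n A) = sat A polySub := by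
  have hloc := isLoc_locMap (k := k) (M := Poly k n) A
  have hc : ∀ m, toRLoc k n A (locMap k n _ A m) = polyToRLoc m := fun m => rfl
  apply le_antisymm
  · rintro _ ⟨y, rfl⟩
    obtain ⟨s, hs, m, hm⟩ := hloc.surj y
    exact ⟨s, hs, m, by rw [← map_smul, hm, hc]⟩
  · rintro z ⟨s, hs, m, hm⟩
    obtain ⟨y, hy⟩ := (hloc.isLocal s hs).2 (locMap k n _ A m)
    refine ⟨y, (isLocal_rLoc A).smul_cancel hs ?_⟩
    dsimp only at hy
    rw [← map_smul, hy, hc, hm]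

lemma injSub_eq_sup (A : Finset (Fin n)) :
    injSub k n A = A.sup fun i => sat (Finset.univ.erase i) polySub := by
  rw [injSub, Finset.sup_eq_iSup]
  simp only [range_toRLoc]

lemma injSub_insert (i : Fin n) (A : Finset (Fin n)) :
    injSub k n (insert i A) = sat (Finset.univ.erase i) polySub ⊔ injSub k n A := by
  rw [injSub_eq_sup, injSub_eq_sup, Finset.sup_insert]

lemma dNilp_poly (i : Fin n) : DNilp i ⊥ (⊤ : Submodule (Diff k n) (Poly k n)) := by
  intro p _
  induction p using MvPolynomial.induction_on' with
  | monomial b c =>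
    refine ⟨b i + 1, fun s hs => ?_⟩
    rw [Submodule.mem_bot, dop_smul_poly, dividedPow_monomial,
      Nat.choose_eq_zero_of_lt (by omega)]
    simp
  | add p q hp hq =>
    obtain ⟨b, hb⟩ := hp trivial
    obtain ⟨c, hc⟩ := hq trivial
    refine ⟨max b c, fun s hs => ?_⟩
    rw [smul_add]
    exact add_mem (hb s (le_of_max_le_left hs)) (hc s (le_of_max_le_right hs))

/-- A polynomial is killed by `∂ᵢ^{[s]}` once `s` exceeds its degree in `xᵢ`, and this survives
inverting the other variables. -/
lemma dNilp_sat_range {N : Type*} [AddCommGroup N] [Module (Diff k n) N]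
    (f : Poly k n →ₗ[Diff k n] N) {i : Fin n} {A : Finset (Fin n)} (hN : IsLocal k A N)
    (hi : i ∉ A) : DNilp i ⊥ (sat A (LinearMap.range f)) := by
  have := ((dNilp_poly (k := k) i).map f).sat hi
  rwa [Submodule.map_bot, hN.sat_bot, Submodule.map_top] at this

lemma dNilp_sat_polySub {i : Fin n} {A : Finset (Fin n)} (hi : i ∉ A) :
    DNilp i ⊥ (sat A (polySub (k := k))) := dNilp_sat_range _ (isLocal_rLoc A) hi

lemma sat_univ_polySub : sat Finset.univ (polySub (k := k) (n := n)) = ⊤ := by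
  refine eq_top_iff.mpr fun y _ => ?_
  obtain ⟨s, hs, m, hm⟩ := isLoc_polyToRLoc.surj y
  exact ⟨s, hs, m, hm.symm⟩

/-- The summand for `i` is nilpotent for `∂ᵢ` only. No single index serves for the whole sum, but
absence of socle passes to sums. -/
lemma socleFree_injSub (A : Finset (Fin n)) : SocleFree ⊥ (injSub k n A) := by
  rw [injSub_eq_sup]
  exact SocleFree.finset_sup _ fun i _ => (dNilp_sat_polySub (Finset.notMem_erase i _)).socleFree

lemma exists_xop_pow_smul_mem {N : Type*} [AddCommGroup N] [Module (Diff k n) N] {i : Fin n}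
    {U : Submodule (Diff k n) N} {y : N} (h : y ∈ sat {i} U) : ∃ t : ℕ, xop (k := k) i ^ t • y ∈ U := by
  obtain ⟨s, hs, hy⟩ := h
  obtain ⟨t, r, -, e⟩ := monoms_dvd_pow hs
  refine ⟨t, ?_⟩
  rw [Finset.prod_singleton] at e
  change r * s = xop i ^ t at e
  rw [← e, mul_smul]
  exact U.smul_mem _ hy

/-- A power of `xᵢ` clears the `xᵢ`-part of the denominator and moves the element into
`R_{x^{1-ε_i}}`. -/
lemma isTorsion_inj : IsTorsion k n (Inj k n Finset.univ) := by
  intro a i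
  obtain ⟨y, rfl⟩ := Submodule.mkQ_surjective _ a
  have : y ∈ sat {i} (sat (Finset.univ.erase i) (polySub (k := k) (n := n))) := by
    rw [sat_sat_union, Finset.union_comm, ← Finset.insert_eq, Finset.insert_erase (Finset.mem_univ i),
      sat_univ_polySub]
    trivial
  obtain ⟨t, ht⟩ := exists_xop_pow_smul_mem this
  refine ⟨t, ?_⟩
  rw [← map_smul, Submodule.mkQ_apply, Submodule.Quotient.mk_eq_zero, injSub_eq_sup]
  exact Finset.le_sup (f := fun i => sat (Finset.univ.erase i) polySub) (Finset.mem_univ i) ht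

lemma sat_finset_sup {N : Type*} [AddCommGroup N] [Module (Diff k n) N] {B : Finset (Fin n)}
    (h : IsLocal k B N) {ι : Type*} (A : Finset ι) (U : ι → Submodule (Diff k n) N) :
    sat B (A.sup U) = A.sup fun i => sat B (U i) := by
  classical
  induction A using Finset.induction_on with
  | empty => simpa using h.sat_bot
  | insert i A _ ih => rw [Finset.sup_insert, Finset.sup_insert, sat_sup h, ih]

lemma isLocal_quotient {N : Type*} [AddCommGroup N] [Module (Diff k n) N] {B : Finset (Fin n)}
    (h : IsLocal k B N) {U : Submodule (Diff k n) N} (hU : sat B U ≤ U) : IsLocal k B (N ⧸ U) := by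
  intro s hs
  constructor
  · intro a b e
    obtain ⟨y, rfl⟩ := Submodule.mkQ_surjective _ a
    obtain ⟨z, rfl⟩ := Submodule.mkQ_surjective _ b
    dsimp only at e
    rw [← map_smul, ← map_smul] at e
    refine (Submodule.Quotient.eq U).mpr (hU ⟨s, hs, ?_⟩)
    rw [smul_sub]
    exact (Submodule.Quotient.eq U).mp e
  · intro a
    obtain ⟨y, rfl⟩ := Submodule.mkQ_surjective _ a
    obtain ⟨z, rfl⟩ := (h s hs).2 y
    exact ⟨U.mkQ z, rfl⟩

/-- For `i ∈ A` the variables indexed by `B` are already invertible in `R_{x^{1-ε_i}}`. -/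
lemma sat_injSub_le {A B : Finset (Fin n)} (h : Disjoint A B) :
    sat B (injSub k n A) ≤ injSub k n A := by
  rw [injSub_eq_sup, sat_finset_sup (isLocal_rLoc B)]
  refine le_of_eq (Finset.sup_congr rfl fun i hi => ?_)
  rw [sat_sat_union, Finset.union_eq_left.mpr]
  intro j hj
  refine Finset.mem_erase.mpr ⟨?_, Finset.mem_univ j⟩
  rintro rfl
  exact Finset.disjoint_left.mp h hi hj

lemma isLocal_inj {A B : Finset (Fin n)} (h : Disjoint A B) : IsLocal k B (Inj k n A) :=
  isLocal_quotient (isLocal_rLoc B) (sat_injSub_le h)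

/-- The epimorphism `E_A → E_B` for `A ⊆ B`. -/
def injMap (k : Type u) [Field k] {n : ℕ} {A B : Finset (Fin n)} (h : A ⊆ B) :
    Inj k n A →ₗ[Diff k n] Inj k n B :=
  Submodule.factor (injSub_mono k n h)

lemma injMap_mkQ {A B : Finset (Fin n)} (h : A ⊆ B) (y : RLoc k n) :
    injMap k h ((injSub k n A).mkQ y) = (injSub k n B).mkQ y := rfl

lemma injMap_comp {A B C : Finset (Fin n)} (h : A ⊆ B) (h' : B ⊆ C) (y : Inj k n A) :
    injMap k h' (injMap k h y) = injMap k (h.trans h') y := by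
  obtain ⟨y, rfl⟩ := Submodule.mkQ_surjective _ y
  rw [injMap_mkQ, injMap_mkQ, injMap_mkQ]

lemma ker_injMap {A B : Finset (Fin n)} (h : A ⊆ B) :
    LinearMap.ker (injMap k h) = (injSub k n B).map (injSub k n A).mkQ := by
  ext a
  obtain ⟨y, rfl⟩ := Submodule.mkQ_surjective _ a
  rw [LinearMap.mem_ker, injMap_mkQ]
  constructor
  · intro hy
    exact ⟨y, (Submodule.Quotient.mk_eq_zero _).mp hy, rfl⟩
  · rintro ⟨z, hz, e⟩
    rw [← injMap_mkQ h, ← e, injMap_mkQ]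
    exact (Submodule.Quotient.mk_eq_zero _).mpr hz

/-- Induction on `A' \ A`, removing one index `i` from `A'`. The composite into `E_{A' \ i}` lands
in the kernel of `E_{A' \ i} → E_{A'}`, an image of `R_{x^{1-ε_i}}` and so nilpotent for `∂ᵢ`. Since
`i ∈ B`, `xᵢ` is surjective on `N`, which forces the composite to vanish. -/
lemma eq_zero_of_injMap_comp_eq_zero {N : Type*} [AddCommGroup N] [Module (Diff k n) N]
    {B : Finset (Fin n)} (hN : IsLocal k B N) {A A' : Finset (Fin n)} (h : A ⊆ A')
    (hB : A' ⊆ A ∪ B) (g : N →ₗ[Diff k n] Inj k n A) (hg : ∀ y, injMap k h (g y) = 0) : g = 0 := by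
  induction hd : (A' \ A) using Finset.induction_on generalizing A' with
  | empty =>
    have : A' = A := le_antisymm (Finset.sdiff_eq_empty_iff_subset.mp hd) h
    subst this
    ext y
    have := hg y
    obtain ⟨z, hz⟩ := Submodule.mkQ_surjective _ (g y)
    rw [← hz] at this ⊢
    exact this
  | insert i S hi ih =>
    have hiA' : i ∈ A' := (Finset.mem_sdiff.mp (hd ▸ Finset.mem_insert_self i S)).1
    have hiA : i ∉ A := (Finset.mem_sdiff.mp (hd ▸ Finset.mem_insert_self i S)).2
    have hAe : A ⊆ A'.erase i := fun j hj =>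
      Finset.mem_erase.mpr ⟨by rintro rfl; exact hiA hj, h hj⟩
    have hiB : i ∈ B := (Finset.mem_union.mp (hB hiA')).resolve_left hiA
    refine ih hAe ((Finset.erase_subset _ _).trans hB) ?_ ?_
    · have h0 : injMap k hAe ∘ₗ g = 0 := by
        refine eq_zero_of_xop_surjective (i := i) _ (hN _ (xop_mem_monoms hiB)).2 ?_
        have hr : LinearMap.range (injMap k hAe ∘ₗ g) ≤
            (sat (Finset.univ.erase i) polySub).map (injSub k n (A'.erase i)).mkQ := by
          have h1 : LinearMap.range (injMap k hAe ∘ₗ g) ≤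
              LinearMap.ker (injMap k (A'.erase_subset i)) := by
            rintro _ ⟨y, rfl⟩
            rw [LinearMap.mem_ker, LinearMap.comp_apply, injMap_comp]
            exact hg y
          rw [ker_injMap] at h1
          have h2 := injSub_insert (k := k) i (A'.erase i)
          rw [Finset.insert_erase hiA'] at h2
          rw [h2, Submodule.map_sup] at h1
          refine h1.trans (sup_le le_rfl ?_)
          rw [Submodule.mkQ_map_self]
          exact bot_le
        have := (dNilp_sat_polySub (k := k) (Finset.notMem_erase i Finset.univ)).map
          (injSub k n (A'.erase i)).mkQ
        rw [Submodule.map_bot] at this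
        exact this.mono le_rfl hr
      exact fun y => congrArg (fun φ => φ y) h0
    · rw [Finset.erase_sdiff_comm, hd, Finset.erase_insert hi]

end RLoc

/-! ### The socle of `E_1` -/

section Socle

variable {k : Type u} [Field k] {n : ℕ}

/-- The product of the variables in `A`, in `D`. -/
def xprod (k : Type u) [Field k] {n : ℕ} (A : Finset (Fin n)) : Diff k n :=
  mul k n (∏ i ∈ A, MvPolynomial.X i)

lemma xprod_mem (A : Finset (Fin n)) : xprod k A ∈ monoms k n A :=
  ⟨_, prod_mem fun i hi => Submonoid.subset_closure ⟨i, hi, rfl⟩, rfl⟩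

lemma xprod_pow_mem (A : Finset (Fin n)) (t : ℕ) : xprod k A ^ t ∈ monoms k n A :=
  pow_mem (xprod_mem A) t

lemma xop_mul_xprod_erase (i : Fin n) :
    xop i * xprod k (Finset.univ.erase i) = xprod k (Finset.univ : Finset (Fin n)) := by
  rw [xop, xprod, xprod, ← Finset.mul_prod_erase _ _ (Finset.mem_univ i)]
  exact ((mul k n).map_mul _ _).symm

lemma xop_pow_mul_xprod_erase_pow (i : Fin n) (t : ℕ) :
    xop i ^ t * xprod k (Finset.univ.erase i) ^ t = xprod k (Finset.univ : Finset (Fin n)) ^ t := by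
  rw [← xop_mul_xprod_erase i]
  exact (Commute.mul_pow (mul_comm' _ _) t).symm

/-- The exponent `(t, …, t)`. -/
def constExp (n t : ℕ) : Fin n →₀ ℕ := Finsupp.equivFunOnFinite.symm fun _ => t

lemma constExp_apply (t : ℕ) (i : Fin n) : constExp n t i = t := rfl

lemma xprod_univ_pow_smul (t : ℕ) (p : Poly k n) :
    xprod k (Finset.univ : Finset (Fin n)) ^ t • p = MvPolynomial.monomial (constExp n t) 1 * p := by
  have h : (∏ i : Fin n, (MvPolynomial.X i : Poly k n)) ^ t =
      MvPolynomial.monomial (constExp n t) 1 := by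
    simp only [MvPolynomial.X, ← MvPolynomial.monomial_sum_one, MvPolynomial.monomial_pow, one_pow]
    congr 2
    ext i
    simp [constExp, Finsupp.single_apply]
  have h' : xprod k (Finset.univ : Finset (Fin n)) ^ t = mul k n ((∏ i, MvPolynomial.X i) ^ t) :=
    ((mul k n).map_pow _ _).symm
  rw [h', mul_smul_poly, h]

lemma xop_pow_smul_poly (i : Fin n) (t : ℕ) (p : Poly k n) :
    xop (k := k) i ^ t • p = MvPolynomial.monomial (Finsupp.single i t) 1 * p := by
  have h' : xop (k := k) i ^ t = mul k n (MvPolynomial.X i ^ t) := ((mul k n).map_pow _ _).symm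
  rw [h', mul_smul_poly, MvPolynomial.X_pow_eq_monomial]

lemma polyToRLoc_injective : Function.Injective (polyToRLoc (k := k) (n := n)) := by
  rw [← LinearMap.ker_eq_bot, LinearMap.ker_eq_bot']
  intro m hm
  obtain ⟨s, hs, h⟩ := isLoc_polyToRLoc.ker m hm
  obtain ⟨N, t, -, e⟩ := monoms_dvd_pow hs
  have h1 : xprod k (Finset.univ : Finset (Fin n)) ^ N • m = 0 := by
    have : (t * s) • m = 0 := by rw [mul_smul, h, smul_zero]
    rwa [e] at this
  rw [xprod_univ_pow_smul] at h1
  exact (mul_eq_zero.mp h1).resolve_left (by simp)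

/-- `y = m / x^t`. -/
def IsFrac (t : ℕ) (y : RLoc k n) (m : Poly k n) : Prop :=
  xprod k (Finset.univ : Finset (Fin n)) ^ t • y = polyToRLoc m

lemma exists_isFrac (y : RLoc k n) : ∃ t m, IsFrac t y m := by
  obtain ⟨s, hs, m, hm⟩ := isLoc_polyToRLoc.surj y
  obtain ⟨N, t, -, e⟩ := monoms_dvd_pow hs
  refine ⟨N, t • m, ?_⟩
  unfold IsFrac
  rw [map_smul, ← hm, ← mul_smul, e]
  rfl

lemma isFrac_monomial_mul_iff {t d : ℕ} {y : RLoc k n} {m : Poly k n} :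
    IsFrac (d + t) y (MvPolynomial.monomial (constExp n d) 1 * m) ↔ IsFrac t y m := by
  unfold IsFrac
  rw [← xprod_univ_pow_smul, map_smul, pow_add, mul_smul]
  exact ((isLocal_rLoc Finset.univ _ (xprod_pow_mem (k := k) _ d)).1.eq_iff :)

lemma IsFrac.add {t : ℕ} {y z : RLoc k n} {m l : Poly k n} (hy : IsFrac t y m)
    (hz : IsFrac t z l) : IsFrac t (y + z) (m + l) := by
  unfold IsFrac at *
  rw [smul_add, hy, hz, map_add]

lemma IsFrac.zero (t : ℕ) : IsFrac t (0 : RLoc k n) 0 := by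
  unfold IsFrac
  rw [smul_zero, map_zero]

lemma IsFrac.right_unique {t : ℕ} {y : RLoc k n} {m l : Poly k n} (hm : IsFrac t y m)
    (hl : IsFrac t y l) : m = l := polyToRLoc_injective (hm.symm.trans hl)

lemma IsFrac.left_unique {t : ℕ} {y z : RLoc k n} {m : Poly k n} (hy : IsFrac t y m)
    (hz : IsFrac t z m) : y = z :=
  (isLocal_rLoc Finset.univ).smul_cancel (xprod_pow_mem _ t) (hy.trans hz.symm)

lemma exists_frac (t : ℕ) (m : Poly k n) : ∃ y, IsFrac t y m :=
  (isLocal_rLoc Finset.univ _ (xprod_pow_mem _ t)).2 (polyToRLoc m)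

lemma IsFrac.xop_smul {t : ℕ} {y : RLoc k n} {m : Poly k n} (h : IsFrac t y m) (i : Fin n) :
    IsFrac t (xop (k := k) i • y) (MvPolynomial.X i * m) := by
  have h2 : MvPolynomial.X i * m = xop (k := k) i • m := rfl
  have h1 : xprod k (Finset.univ : Finset (Fin n)) ^ t * xop (k := k) i = xop i * xprod k (Finset.univ : Finset (Fin n)) ^ t :=
    (Commute.pow_right (mul_comm' _ _) t : Commute (xop i) _).symm
  unfold IsFrac at *
  rw [h2, map_smul, ← mul_smul, h1, mul_smul, h]

lemma mem_sat_erase_of_isFrac {t : ℕ} {y : RLoc k n} {m : Poly k n} {i : Fin n}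
    (h : IsFrac t y (MvPolynomial.monomial (Finsupp.single i t) 1 * m)) :
    y ∈ sat (Finset.univ.erase i) polySub := by
  refine ⟨_, xprod_pow_mem _ t, m, ?_⟩
  refine (isLocal_rLoc Finset.univ).smul_cancel
    (pow_mem (xop_mem_monoms (Finset.mem_univ i)) t) ?_
  rw [← map_smul, xop_pow_smul_poly, ← mul_smul, xop_pow_mul_xprod_erase_pow]
  exact h.symm

lemma exists_le_of_mem_sat {t : ℕ} {y : RLoc k n} {m : Poly k n} {i : Fin n}
    (hy : y ∈ sat (Finset.univ.erase i) polySub) (h : IsFrac t y m) :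
    ∀ b ∈ m.support, t ≤ b i := by
  obtain ⟨s, hs, m', hm'⟩ := hy
  obtain ⟨N, r, -, e⟩ := monoms_dvd_pow hs
  -- Over the common denominator `x^{N+t}`, one numerator of `y` is `x^N m`; this one is divisible
  -- by `xᵢ^{N+t}`, because the given denominator `s` does not involve `xᵢ`.
  have h1 : IsFrac (N + t) y (MvPolynomial.monomial (Finsupp.single i (N + t)) 1 *
      (xprod k (Finset.univ.erase i) ^ t • r • m')) := by
    unfold IsFrac
    rw [← xop_pow_smul_poly, map_smul, map_smul, map_smul, hm', ← mul_smul r, e,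
      ← xop_pow_mul_xprod_erase_pow i, mul_smul, add_comm N t, pow_add (xprod k _), mul_smul]
    rfl
  have h2 := (isFrac_monomial_mul_iff (d := N).mpr h).right_unique h1
  intro b hb
  rw [MvPolynomial.mem_support_iff] at hb
  have h3 := congrArg (MvPolynomial.coeff (constExp n N + b)) h2
  rw [MvPolynomial.coeff_monomial_mul, one_mul, MvPolynomial.coeff_monomial_mul'] at h3
  split_ifs at h3 with hle
  · have := hle i
    rw [Finsupp.single_eq_same, Finsupp.add_apply, constExp_apply] at this
    omega
  · exact absurd h3 hb

lemma exists_le_of_mem_injSub {y : RLoc k n} (hy : y ∈ injSub k n Finset.univ) :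
    ∀ {t : ℕ} {m : Poly k n}, IsFrac t y m → ∀ b ∈ m.support, ∃ i, t ≤ b i := by
  rw [injSub_eq_sup, Finset.sup_univ_eq_iSup] at hy
  refine Submodule.iSup_induction _ (motive := fun y => ∀ {t : ℕ} {m : Poly k n}, IsFrac t y m →
    ∀ b ∈ m.support, ∃ i, t ≤ b i) hy ?_ ?_ ?_
  · intro i y hy t m h b hb
    exact ⟨i, exists_le_of_mem_sat hy h b hb⟩
  · intro t m h b hb
    rw [h.right_unique (IsFrac.zero t)] at hb
    simp at hb
  · intro y z ihy ihz t m h b hb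
    obtain ⟨t₁, m₁, h₁⟩ := exists_isFrac y
    obtain ⟨t₂, m₂, h₂⟩ := exists_isFrac z
    -- All three fractions are brought to the exponent `t₁ + t₂ + t`; a monomial of the sum must
    -- then occur in one of the two numerators.
    have H := isFrac_monomial_mul_iff (d := t₁ + t₂).mpr h
    have H₁ := isFrac_monomial_mul_iff (d := t₂ + t).mpr h₁
    have H₂ := isFrac_monomial_mul_iff (d := t₁ + t).mpr h₂
    rw [show t₂ + t + t₁ = t₁ + t₂ + t by ring] at H₁
    rw [show t₁ + t + t₂ = t₁ + t₂ + t by ring] at H₂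
    have e := congrArg (MvPolynomial.coeff (constExp n (t₁ + t₂) + b)) (H.right_unique (H₁.add H₂))
    rw [MvPolynomial.coeff_monomial_mul, one_mul, MvPolynomial.coeff_add] at e
    rw [MvPolynomial.mem_support_iff, e] at hb
    have : ∃ i, t₁ + t₂ + t ≤ (constExp n (t₁ + t₂) + b) i := by
      by_cases h0 : MvPolynomial.coeff (constExp n (t₁ + t₂) + b)
          (MvPolynomial.monomial (constExp n (t₂ + t)) 1 * m₁) = 0
      · rw [h0, zero_add] at hb
        exact ihz H₂ _ (MvPolynomial.mem_support_iff.mpr hb)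
      · exact ihy H₁ _ (MvPolynomial.mem_support_iff.mpr h0)
    obtain ⟨i, hi⟩ := this
    rw [Finsupp.add_apply, constExp_apply] at hi
    exact ⟨i, by omega⟩

lemma mem_injSub_of_exists_le {t : ℕ} {y : RLoc k n} {m : Poly k n} (h : IsFrac t y m)
    (hm : ∀ b ∈ m.support, ∃ i, t ≤ b i) : y ∈ injSub k n Finset.univ := by
  choose z hz using fun b => exists_frac t (MvPolynomial.monomial b (MvPolynomial.coeff b m))
  have hy : y = ∑ b ∈ m.support, z b := by
    refine h.left_unique ?_
    unfold IsFrac at hz ⊢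
    rw [Finset.smul_sum, Finset.sum_congr rfl fun b _ => hz b, ← map_sum,
      MvPolynomial.support_sum_monomial_coeff]
  rw [hy]
  refine sum_mem fun b hb => ?_
  obtain ⟨i, hi⟩ := hm b hb
  rw [injSub_eq_sup]
  refine Finset.le_sup (f := fun i => sat (Finset.univ.erase i) polySub) (Finset.mem_univ i)
    (mem_sat_erase_of_isFrac (t := t)
      (m := MvPolynomial.monomial (b - Finsupp.single i t) (MvPolynomial.coeff b m)) ?_)
  rw [MvPolynomial.monomial_mul, one_mul, add_tsub_cancel_of_le (by simpa using hi)]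
  exact hz b

/-- The element `1 / (x₁ ⋯ xₙ)` of `R_{x^1}`. -/
def eta (k : Type u) [Field k] (n : ℕ) : RLoc k n := (exists_frac (k := k) (n := n) 1 1).choose

lemma isFrac_eta : IsFrac 1 (eta k n) 1 := (exists_frac (k := k) (n := n) 1 1).choose_spec

lemma eta_notMem : eta k n ∉ injSub k n Finset.univ := by
  intro h
  obtain ⟨i, hi⟩ := exists_le_of_mem_injSub h isFrac_eta 0 (by simp)
  simp at hi

lemma xop_smul_eta_mem (i : Fin n) :
    xop (k := k) i • eta k n ∈ sat (Finset.univ.erase i) polySub := by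
  refine mem_sat_erase_of_isFrac (t := 1) (m := 1) ?_
  exact isFrac_eta.xop_smul i

lemma smul_eq_mul_C_smul (c : k) (y : RLoc k n) : c • y = mul k n (MvPolynomial.C c) • y := rfl

/-- Modulo the submodule, only monomials of the numerator with all exponents at most `t` matter. If
one of them has `bᵢ < t`, then multiplying by `xᵢ` keeps it nonzero in `E_1`; so for a socle element
only `(t, …, t)` survives, that is, a multiple of `1/(x₁⋯xₙ)`. -/
lemma socle_inj (e : Inj k n Finset.univ) (he : ∀ i : Fin n, xop (k := k) i • e = 0) :
    ∃ c : k, e = c • (injSub k n Finset.univ).mkQ (eta k n) := by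
  obtain ⟨y, rfl⟩ := Submodule.mkQ_surjective _ e
  -- With denominator exponent `1 + t`, the monomial with exponent `(t, …, t)` represents
  -- `1/(x₁⋯xₙ)`.
  obtain ⟨t, m, hm⟩ : ∃ t m, IsFrac (1 + t) y m := by
    obtain ⟨t, m, h⟩ := exists_isFrac y
    exact ⟨t, _, isFrac_monomial_mul_iff.mpr h⟩
  refine ⟨MvPolynomial.coeff (constExp n t) m, ?_⟩
  set c := MvPolynomial.coeff (constExp n t) m
  have hη : IsFrac (1 + t) (c • eta k n) (MvPolynomial.monomial (constExp n t) c) := by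
    have h1 := isFrac_monomial_mul_iff (d := t).mpr (isFrac_eta (k := k) (n := n))
    rw [add_comm t 1] at h1
    have h2 : MvPolynomial.monomial (constExp n t) c =
        mul k n (MvPolynomial.C c) • (MvPolynomial.monomial (constExp n t) (1 : k) * 1) := by
      rw [mul_smul_poly, MvPolynomial.C_mul', mul_one, MvPolynomial.smul_monomial, smul_eq_mul,
        mul_one]
    unfold IsFrac at *
    rw [h2, map_smul, ← h1, smul_eq_mul_C_smul, ← mul_smul, ← mul_smul]
    congr 1
    exact Commute.pow_left (mul_comm' (k := k) _ _) (1 + t)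
  have hsub : IsFrac (1 + t) (y - c • eta k n) (m - MvPolynomial.monomial (constExp n t) c) := by
    unfold IsFrac at *
    rw [smul_sub, hm, hη, map_sub]
  have key : y - c • eta k n ∈ injSub k n Finset.univ := by
    refine mem_injSub_of_exists_le hsub fun b hb => ?_
    rw [MvPolynomial.mem_support_iff, MvPolynomial.coeff_sub, MvPolynomial.coeff_monomial] at hb
    by_contra! hlt
    by_cases hbt : constExp n t = b
    · rw [if_pos hbt, ← hbt, sub_self] at hb
      exact hb rfl
    · rw [if_neg hbt, sub_zero] at hb
      obtain ⟨i, hi⟩ : ∃ i, b i < t := by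
        by_contra! hge
        refine hbt (Finsupp.ext fun i => ?_)
        rw [constExp_apply]
        have := hge i
        have := hlt i
        omega
      have hx : xop (k := k) i • y ∈ injSub k n Finset.univ := by
        have := he i
        rw [← map_smul] at this
        exact (Submodule.Quotient.mk_eq_zero _).mp this
      obtain ⟨j, hj⟩ := exists_le_of_mem_injSub hx (hm.xop_smul i) (Finsupp.single i 1 + b) (by
        rw [MvPolynomial.mem_support_iff, MvPolynomial.coeff_X_mul]
        exact hb)
      rw [Finsupp.add_apply, Finsupp.single_apply] at hj
      have := hlt j
      split_ifs at hj with hij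
      · subst hij; omega
      · omega
  exact (Submodule.Quotient.eq _).mpr key

lemma eq_top_of_eta_mem {Q : Submodule (Diff k n) (Inj k n Finset.univ)}
    (h : (injSub k n Finset.univ).mkQ (eta k n) ∈ Q) : Q = ⊤ := by
  refine eq_top_iff.mpr fun a _ => mem_of_socle_le isTorsion_inj Q (fun b hb => ?_) a
  obtain ⟨c, rfl⟩ := socle_inj b hb
  exact Submodule.smul_of_tower_mem Q c h

/-- A nonzero submodule of a torsion module meets the socle, which here is the line spanned by the
class of `eta`, and this class generates. -/
instance : IsSimpleModule (Diff k n) (Inj k n Finset.univ) := by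
  rw [isSimpleModule_iff]
  have hη : (injSub k n Finset.univ).mkQ (eta k n) ≠ 0 :=
    fun h => eta_notMem ((Submodule.Quotient.mk_eq_zero _).mp h)
  have hbt : (⊥ : Submodule (Diff k n) (Inj k n Finset.univ)) ≠ ⊤ := by
    intro h
    have : (injSub k n Finset.univ).mkQ (eta k n) ∈
        (⊥ : Submodule (Diff k n) (Inj k n Finset.univ)) := by rw [h]; trivial
    exact hη ((Submodule.mem_bot _).mp this)
  refine { exists_pair_ne := ⟨⊥, ⊤, hbt⟩, eq_bot_or_eq_top := fun Q => ?_ }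
  by_cases hQ : ∃ b ∈ Q, (∀ i : Fin n, xop (k := k) i • b = 0) ∧ b ≠ 0
  · obtain ⟨b, hb, hx, h0⟩ := hQ
    obtain ⟨c, rfl⟩ := socle_inj b hx
    have hc : c ≠ 0 := by
      rintro rfl
      exact h0 (zero_smul k _)
    refine Or.inr (eq_top_of_eta_mem ?_)
    have := Submodule.smul_of_tower_mem Q c⁻¹ hb
    rwa [smul_smul, inv_mul_cancel₀ hc, one_smul] at this
  · push Not at hQ
    refine Or.inl (le_bot_iff.mp fun a ha => ?_)
    refine mem_of_forall_xop_pow_smul_mem (U := Q)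
      (fun b hb hx => (Submodule.mem_bot _).mpr (hQ b hb fun i => (Submodule.mem_bot _).mp (hx i)))
      ha fun i => ?_
    obtain ⟨t, ht⟩ := isTorsion_inj a i
    exact ⟨t, (Submodule.mem_bot _).mpr ht⟩

/-- Every `D`-linear map `R_{x^1} → E_1` is a multiple of the canonical epimorphism. -/
lemma exists_eq_smul_mkQ (f : RLoc k n →ₗ[Diff k n] Inj k n Finset.univ) :
    ∃ c : k, ∀ y, f y = c • (injSub k n Finset.univ).mkQ y := by
  have hf : ∀ y ∈ injSub k n Finset.univ, f y = 0 := fun y hy =>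
    (socleFree_injSub Finset.univ).map_eq_zero isTorsion_inj f bot_le hy
  obtain ⟨c, hc⟩ := socle_inj (f (eta k n)) fun i => by
    rw [← map_smul]
    refine hf _ ?_
    rw [injSub_eq_sup]
    exact Finset.le_sup (f := fun i => sat (Finset.univ.erase i) polySub) (Finset.mem_univ i)
      (xop_smul_eta_mem i)
  refine ⟨c, fun y => ?_⟩
  -- The difference descends to `E_1` and kills the class of `eta`, a generator.
  let g : RLoc k n →ₗ[Diff k n] Inj k n Finset.univ := f - c • (injSub k n Finset.univ).mkQ
  have hg : injSub k n Finset.univ ≤ LinearMap.ker g := by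
    intro y hy
    rw [LinearMap.mem_ker, LinearMap.sub_apply, hf y hy, LinearMap.smul_apply, Submodule.mkQ_apply,
      (Submodule.Quotient.mk_eq_zero _).mpr hy, smul_zero, sub_zero]
  have hker : LinearMap.ker ((injSub k n Finset.univ).liftQ g hg) = ⊤ := by
    refine eq_top_of_eta_mem ?_
    rw [LinearMap.mem_ker, Submodule.mkQ_apply, Submodule.liftQ_apply, LinearMap.sub_apply,
      LinearMap.smul_apply, hc, sub_self]
  have : (injSub k n Finset.univ).mkQ y ∈ LinearMap.ker ((injSub k n Finset.univ).liftQ g hg) := by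
    rw [hker]; trivial
  rw [LinearMap.mem_ker, Submodule.mkQ_apply, Submodule.liftQ_apply, LinearMap.sub_apply,
    LinearMap.smul_apply] at this
  exact sub_eq_zero.mp this

end Socle

/-! ### The local cohomology of the polynomial ring in top degree -/

section TopCohomology

lemma exists_surjective_to_shortComplex_homology {D : Type u} [Ring D]
    (S : ShortComplex (ModuleCat.{v} D)) (hg : S.g = 0) :
    ∃ p : S.X₂ →ₗ[D] S.homology, Function.Surjective p ∧
      LinearMap.ker p = LinearMap.range S.f.hom := by
  let φ : S.X₂ ⟶ S.homology := S.pOpcycles ≫ (S.asIsoHomologyι hg).inv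
  refine ⟨φ.hom, (ModuleCat.epi_iff_surjective φ).mp (epi_comp _ _), ?_⟩
  ext x
  rw [LinearMap.mem_ker]
  have h1 : φ.hom x = (S.asIsoHomologyι hg).inv.hom (S.pOpcycles.hom x) := rfl
  have hinj : Function.Injective (S.asIsoHomologyι hg).inv.hom :=
    (ModuleCat.mono_iff_injective _).mp inferInstance
  rw [h1, map_eq_zero_iff _ hinj]
  exact S.moduleCat_pOpcycles_eq_zero_iff x

lemma exists_surjective_to_homology {D : Type u} [Ring D]
    (K : CochainComplex (ModuleCat.{v} D) ℕ) {i c : ℕ} (hi : (ComplexShape.up ℕ).prev c = i)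
    (h : K.d c (c + 1) = 0) :
    ∃ p : K.X c →ₗ[D] K.homology c, Function.Surjective p ∧
      LinearMap.ker p = LinearMap.range (K.d i c).hom := by
  subst hi
  refine exists_surjective_to_shortComplex_homology (K.sc c) ?_
  have hn : (ComplexShape.up ℕ).next c = c + 1 := CochainComplex.next _ c
  change K.d c ((ComplexShape.up ℕ).next c) = 0
  rw [hn, h]

lemma cubeD_apply {S : Type u} [Ring S] {n : ℕ} (Q : Finset (Fin n) ⥤ ModuleCat.{v} S)
    (P P' : Finset (Fin n) → Prop) (h : ∀ C, P' C → ∀ i ∈ C, P (C.erase i))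
    (w : ∀ B : {B // P B}, Q.obj B.1) (C : {C // P' C}) :
    cubeD Q P P' h w C = ∑ i ∈ C.1.attach, sgn i.1 C.1 •
      (Q.map (homOfLE (C.1.erase_subset i.1))).hom (w ⟨C.1.erase i.1, h C.1 C.2 i.1 i.2⟩) := by
  simp [cubeD]

variable {k : Type u} [Field k] {n : ℕ} (M : Type v) [AddCommGroup M] [Module (Diff k n) M]

lemma cech_d (A : Finset (Fin n)) (c : ℕ) : (cech k n M A).d c (c + 1) =
    ModuleCat.ofHom (cubeD (locCube k n M) (fun B => B ⊆ A ∧ B.card = c)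
      (fun B => B ⊆ A ∧ B.card = c + 1)
      (fun C hC i hi => ⟨(C.erase_subset i).trans hC.1, by
        rw [Finset.card_erase_of_mem hi, hC.2, Nat.add_sub_cancel]⟩)) :=
  CochainComplex.of_d
    (fun p => ModuleCat.of (Diff k n)
      (∀ B : {B : Finset (Fin n) // B ⊆ A ∧ B.card = p}, (locCube k n M).obj B.1))
    (fun p => ModuleCat.ofHom (cubeD (locCube k n M) (fun B => B ⊆ A ∧ B.card = p)
      (fun B => B ⊆ A ∧ B.card = p + 1)
      (fun C hC i hi => ⟨(C.erase_subset i).trans hC.1, by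
        rw [Finset.card_erase_of_mem hi, hC.2, Nat.add_sub_cancel]⟩))) c

lemma sgn_mul_self (i : Fin n) (C : Finset (Fin n)) : sgn i C * sgn i C = 1 := by
  rw [sgn, ← mul_pow]
  simp

/-- In degree `|A|` the only index is `A` itself and the outgoing differential is zero, so the
homology is the cokernel of the incoming one. Signs do not affect its range. -/
lemma exists_surjective_loc_to_homology (A : Finset (Fin n)) {c : ℕ} (hc : A.card = c) :
    ∃ p : Loc k n M A →ₗ[Diff k n] (cech k n M A).homology c, Function.Surjective p ∧
      LinearMap.ker p = ⨆ i ∈ A,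
        LinearMap.range (oreMap M (monoms_mono k n (A.erase_subset i))) := by
  have hd : (cech k n M A).d c (c + 1) = 0 := by
    rw [cech_d]
    refine ModuleCat.hom_ext (LinearMap.ext fun w => funext fun C => ?_)
    have := Finset.card_le_card C.2.1
    have := C.2.2
    omega
  let b₀ : {B : Finset (Fin n) // B ⊆ A ∧ B.card = c} := ⟨A, subset_rfl, hc⟩
  have hb : ∀ b : {B : Finset (Fin n) // B ⊆ A ∧ B.card = c}, b = b₀ := fun b =>
    Subtype.ext (Finset.eq_of_subset_of_card_le b.2.1 (by rw [b.2.2, hc]))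
  let ev : (cech k n M A).X c →ₗ[Diff k n] Loc k n M A :=
    LinearMap.proj (φ := fun B : {B : Finset (Fin n) // B ⊆ A ∧ B.card = c} =>
      (locCube k n M).obj B.1) b₀
  have hev : Function.Bijective ev := by
    constructor
    · intro w w' e
      funext b
      rw [hb b]
      exact e
    · intro y
      exact ⟨Pi.single b₀ y, Pi.single_eq_same (M := fun B : {B : Finset (Fin n) //
        B ⊆ A ∧ B.card = c} => (locCube k n M).obj B.1) b₀ y⟩
  let E := LinearEquiv.ofBijective ev hev
  have key : ∀ (i : ℕ), (ComplexShape.up ℕ).prev c = i →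
      (LinearMap.range ((cech k n M A).d i c).hom).map ev = ⨆ i ∈ A,
        LinearMap.range (oreMap M (monoms_mono k n (A.erase_subset i))) →
      ∃ p : Loc k n M A →ₗ[Diff k n] (cech k n M A).homology c, Function.Surjective p ∧
      LinearMap.ker p = ⨆ i ∈ A,
        LinearMap.range (oreMap M (monoms_mono k n (A.erase_subset i))) := by
    intro i hi hr
    obtain ⟨p, hp, hker⟩ := exists_surjective_to_homology (cech k n M A) hi hd
    refine ⟨p ∘ₗ E.symm.toLinearMap, hp.comp E.symm.surjective, ?_⟩
    rw [LinearMap.ker_comp, hker, ← hr]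
    exact (Submodule.map_equiv_eq_comap_symm E _).symm
  cases c with
  | zero =>
    -- By convention degree `0` is its own predecessor, with zero differential; as `A` is empty, the
    -- supremum is zero too.
    refine key 0 CochainComplex.prev_nat_zero ?_
    rw [(cech k n M A).shape 0 0 (by simp)]
    refine Eq.trans (b := ⊥) ?_ (iSup₂_eq_bot.mpr fun i hi => ?_).symm
    · exact (congrArg (Submodule.map ev) LinearMap.range_zero).trans (Submodule.map_bot ev)
    · rw [Finset.card_eq_zero.mp hc] at hi
      exact absurd hi (Finset.notMem_empty i)
  | succ c =>
    refine key c (CochainComplex.prev_nat_succ c) ?_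
    have hformula : ∀ w, ev (((cech k n M A).d c (c + 1)).hom w) = ∑ i ∈ A.attach, sgn i.1 A •
        oreMap M (monoms_mono k n (A.erase_subset i.1))
          (w (⟨A.erase i.1, A.erase_subset i.1, by
            rw [Finset.card_erase_of_mem i.2, hc, Nat.add_sub_cancel]⟩ :
              {B : Finset (Fin n) // B ⊆ A ∧ B.card = c})) := by
      intro w
      refine (congrArg (fun f => ev (ModuleCat.Hom.hom f w)) (cech_d M A c)).trans ?_
      have := cubeD_apply (locCube k n M) (fun B => B ⊆ A ∧ B.card = c)
        (fun C => C ⊆ A ∧ C.card = c + 1) (fun C hC i hi => ⟨(C.erase_subset i).trans hC.1, by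
        rw [Finset.card_erase_of_mem hi, hC.2, Nat.add_sub_cancel]⟩) w b₀
      refine Eq.trans (b := ev _) rfl (this.trans ?_)
      refine (Finset.sum_congr rfl fun i _ => ?_).trans rfl
      rfl
    apply le_antisymm
    · rintro _ ⟨_, ⟨w, rfl⟩, rfl⟩
      rw [hformula]
      refine sum_mem fun i _ => zsmul_mem ?_ _
      exact Submodule.mem_iSup_of_mem i.1 (Submodule.mem_iSup_of_mem i.2 ⟨_, rfl⟩)
    · refine iSup₂_le fun i hi => ?_
      rintro _ ⟨y, rfl⟩
      -- The factor `sgn i A` cancels the sign in the differential.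
      let w : (cech k n M A).X c := Pi.single (M := fun B : {B : Finset (Fin n) //
        B ⊆ A ∧ B.card = c} => (locCube k n M).obj B.1) ⟨A.erase i, A.erase_subset i, by
            rw [Finset.card_erase_of_mem hi, hc, Nat.add_sub_cancel]⟩ (sgn i A • y)
      refine ⟨_, ⟨w, rfl⟩, ?_⟩
      rw [hformula, Finset.sum_eq_single ⟨i, hi⟩]
      · have : w ⟨A.erase i, A.erase_subset i, by
            rw [Finset.card_erase_of_mem hi, hc, Nat.add_sub_cancel]⟩ = sgn i A • y :=
          Pi.single_eq_same _ _
        rw [this, map_zsmul, smul_smul, sgn_mul_self, one_smul]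
      · rintro ⟨j, hj⟩ _ hij
        have : w ⟨A.erase j, A.erase_subset j, by
            rw [Finset.card_erase_of_mem hj, hc, Nat.add_sub_cancel]⟩ = 0 := by
          refine Pi.single_eq_of_ne ?_ _
          intro e
          have e' : A.erase j = A.erase i := congrArg Subtype.val e
          have : i ∈ A.erase j := Finset.mem_erase.mpr ⟨by
            rintro rfl; exact hij rfl, hi⟩
          rw [e'] at this
          exact Finset.notMem_erase i A this
        rw [this]
        exact (congrArg (fun z => sgn j A • z)
          (map_zero (oreMap M (monoms_mono k n (A.erase_subset j))))).trans (zsmul_zero _)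
      · intro h; exact absurd (Finset.mem_attach _ _) h

/-- The local cohomology of `R` in top degree as a quotient of a localization. -/
lemma exists_surjective_loc_to_localCoh (A : Finset (Fin n)) :
    ∃ p : Loc k n M A →ₗ[Diff k n] localCoh k n M A A.card, Function.Surjective p ∧
      LinearMap.ker p = ⨆ i ∈ A,
        LinearMap.range (oreMap M (monoms_mono k n (A.erase_subset i))) :=
  exists_surjective_loc_to_homology M A rfl

end TopCohomology

/-! ### Torsion, nilpotency and localization of the modules `H^{|A|}_{𝔭_A}(R)`. -/

section TopCohomologyOfPoly

variable {k : Type u} [Field k] {n : ℕ}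

lemma exists_monoms_forall {B : Finset (Fin n)} {ι : Type*} [Finite ι] {p : ι → Diff k n → Prop}
    (hp : ∀ c r s, p c s → p c (r * s)) (h : ∀ c, ∃ s ∈ monoms k n B, p c s) :
    ∃ s ∈ monoms k n B, ∀ c, p c s := by
  classical
  cases nonempty_fintype ι
  have key : ∀ S : Finset ι, ∃ s ∈ monoms k n B, ∀ c ∈ S, p c s := by
    intro S
    induction S using Finset.induction_on with
    | empty => exact ⟨1, one_mem _, by simp⟩
    | insert c S _ ih =>
      obtain ⟨s, hs, hS⟩ := ih
      obtain ⟨t, ht, hc⟩ := h c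
      refine ⟨t * s, mul_mem ht hs, fun d hd => ?_⟩
      rcases Finset.mem_insert.mp hd with rfl | hd
      · rw [monoms_comm ht hs]
        exact hp _ _ _ hc
      · exact hp _ _ _ (hS d hd)
  obtain ⟨s, hs, h⟩ := key Finset.univ
  exact ⟨s, hs, fun c => h c (Finset.mem_univ c)⟩

lemma exists_monoms_forall_smul_eq_zero {B : Finset (Fin n)} {ι : Type*} [Finite ι]
    {X : ι → Type*} [∀ c, AddCommGroup (X c)] [∀ c, Module (Diff k n) (X c)] (x : ∀ c, X c)
    (h : ∀ c, ∃ s ∈ monoms k n B, s • x c = 0) : ∃ s ∈ monoms k n B, s • x = 0 := by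
  obtain ⟨s, hs, h⟩ := exists_monoms_forall (p := fun c s => s • x c = 0)
    (fun c r s h => by rw [mul_smul, h, smul_zero]) h
  exact ⟨s, hs, funext h⟩

lemma IsLoc.compLeft {M N : Type*} [AddCommGroup M] [Module (Diff k n) M] [AddCommGroup N]
    [Module (Diff k n) N] {B : Finset (Fin n)} {f : M →ₗ[Diff k n] N} (hf : IsLoc B f)
    (ι : Type*) [Finite ι] : IsLoc B (f.compLeft ι) where
  isLocal := hf.isLocal.pi
  surj y := by
    obtain ⟨s, hs, h⟩ := exists_monoms_forall (p := fun c s => ∃ m, s • y c = f m)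
      (fun c r s ⟨m, h⟩ => ⟨r • m, by rw [mul_smul, h, map_smul]⟩) fun c => hf.surj (y c)
    choose m hm using h
    exact ⟨s, hs, m, funext hm⟩
  ker m hm := exists_monoms_forall_smul_eq_zero m fun c => hf.ker _ (congrFun hm c)

lemma exists_factor {D : Type*} [Ring D] {X Y Z : Type*} [AddCommGroup X] [Module D X]
    [AddCommGroup Y] [Module D Y] [AddCommGroup Z] [Module D Z] {f : X →ₗ[D] Y} {g : X →ₗ[D] Z}
    (hf : Function.Surjective f) (h : LinearMap.ker f ≤ LinearMap.ker g) :
    ∃ φ : Y →ₗ[D] Z, ∀ x, φ (f x) = g x := by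
  refine ⟨(LinearMap.ker f).liftQ g h ∘ₗ (f.quotKerEquivOfSurjective hf).symm.toLinearMap,
    fun x => ?_⟩
  have : (f.quotKerEquivOfSurjective hf).symm (f x) = (LinearMap.ker f).mkQ x := by
    rw [LinearEquiv.symm_apply_eq]
    rfl
  rw [LinearMap.comp_apply, LinearEquiv.coe_coe, this, Submodule.mkQ_apply, Submodule.liftQ_apply]

lemma range_oreMap {M : Type v} [AddCommGroup M] [Module (Diff k n) M] {C A : Finset (Fin n)}
    (h : C ⊆ A) : LinearMap.range (oreMap M (monoms_mono k n h)) =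
      sat C (LinearMap.range (locMap k n M A)) := by
  have hloc := isLoc_locMap (k := k) (M := M) C
  have hA := (isLoc_locMap (k := k) (M := M) A).isLocal.mono h
  apply le_antisymm
  · rintro _ ⟨y, rfl⟩
    obtain ⟨s, hs, m, hm⟩ := hloc.surj y
    exact ⟨s, hs, m, by rw [← map_smul, hm, oreMap_locMap h]⟩
  · rintro z ⟨s, hs, m, hm⟩
    obtain ⟨y, hy⟩ := (hloc.isLocal s hs).2 (locMap k n _ C m)
    refine ⟨y, hA.smul_cancel hs ?_⟩
    dsimp only at hy
    rw [← map_smul, hy, oreMap_locMap h, hm]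

lemma sat_range_locMap {M : Type v} [AddCommGroup M] [Module (Diff k n) M] (A : Finset (Fin n)) :
    sat A (LinearMap.range (locMap k n M A)) = ⊤ := by
  refine eq_top_iff.mpr fun y _ => ?_
  obtain ⟨s, hs, m, hm⟩ := (isLoc_locMap (k := k) (M := M) A).surj y
  exact ⟨s, hs, m, hm.symm⟩

lemma toRLoc_injective (A : Finset (Fin n)) : Function.Injective (toRLoc k n A) := by
  rw [← LinearMap.ker_eq_bot, LinearMap.ker_eq_bot']
  intro y hy
  have hA := isLoc_locMap (k := k) (M := Poly k n) A
  obtain ⟨s, hs, m, hm⟩ := hA.surj y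
  have h1 : polyToRLoc m = 0 := by
    change toRLoc k n A (locMap k n _ A m) = 0
    rw [← hm, map_smul, hy, smul_zero]
  have h2 : m = 0 := polyToRLoc_injective (h1.trans (map_zero _).symm)
  refine hA.isLocal.smul_cancel hs ?_
  rw [hm, h2, map_zero, smul_zero]

lemma exists_xop_pow_smul_localCoh_eq_zero {A : Finset (Fin n)} {i : Fin n} (hi : i ∈ A)
    (h : localCoh k n (Poly k n) A A.card) : ∃ t : ℕ, xop (k := k) i ^ t • h = 0 := by
  obtain ⟨p, hp, hker⟩ := exists_surjective_loc_to_localCoh (k := k) (Poly k n) A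
  obtain ⟨y, rfl⟩ := hp h
  have hy : y ∈ sat {i} (sat (A.erase i) (LinearMap.range (locMap k n (Poly k n) A))) := by
    rw [sat_sat_union, Finset.union_comm, ← Finset.insert_eq, Finset.insert_erase hi,
      sat_range_locMap]
    trivial
  obtain ⟨t, ht⟩ := exists_xop_pow_smul_mem hy
  refine ⟨t, ?_⟩
  rw [← map_smul, ← LinearMap.mem_ker, hker]
  rw [← range_oreMap (A.erase_subset i)] at ht
  exact Submodule.mem_iSup_of_mem i (Submodule.mem_iSup_of_mem hi ht)

lemma dNilp_localCoh {A : Finset (Fin n)} {i : Fin n} (hi : i ∉ A) :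
    DNilp i ⊥ (⊤ : Submodule (Diff k n) (localCoh k n (Poly k n) A A.card)) := by
  obtain ⟨p, hp, -⟩ := exists_surjective_loc_to_localCoh (k := k) (Poly k n) A
  have := (dNilp_sat_range (locMap k n (Poly k n) A) (isLoc_locMap A).isLocal hi).map p
  rwa [sat_range_locMap, Submodule.map_bot, Submodule.map_top, LinearMap.range_eq_top.mpr hp] at this

lemma erase_union_compl {A : Finset (Fin n)} {i : Fin n} (hi : i ∈ A) :
    A.erase i ∪ Aᶜ = Finset.univ.erase i := by
  ext j
  simp only [Finset.mem_union, Finset.mem_erase, Finset.mem_compl, Finset.mem_univ, and_true]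
  constructor
  · rintro (h | h)
    · exact h.1
    · rintro rfl; exact h hi
  · intro h
    by_cases hj : j ∈ A
    · exact Or.inl ⟨h, hj⟩
    · exact Or.inr hj

/-- The module `E_A` is the localization of `H^{|A|}_{𝔭_A}(R)` at the variables outside `A`. -/
lemma exists_isLoc_localCoh_inj (A : Finset (Fin n)) :
    ∃ l : localCoh k n (Poly k n) A A.card →ₗ[Diff k n] Inj k n A, IsLoc Aᶜ l := by
  obtain ⟨p, hp, hker⟩ := exists_surjective_loc_to_localCoh (k := k) (Poly k n) A
  have hmap : ∀ i (hi : i ∈ A), (LinearMap.range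
      (oreMap (Poly k n) (monoms_mono k n (A.erase_subset i)))).map (toRLoc k n A) =
        sat (A.erase i) polySub := by
    intro i _
    rw [← LinearMap.range_comp, ← range_toRLoc]
    congr 1
    exact oreMap_comp _ _ _
  have hkermap : (LinearMap.ker p).map (toRLoc k n A) = A.sup fun i => sat (A.erase i) polySub := by
    rw [hker, Finset.sup_eq_iSup]
    simp only [Submodule.map_iSup]
    exact iSup_congr fun i => iSup_congr fun hi => hmap i hi
  -- Inverting the variables outside `A` turns `R_{x^{A \ i}}` into `R_{x^{1-ε_i}}`, so the
  -- relations defining `E_A` are the localized relations of the local cohomology module.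
  have hsub : injSub k n A = sat Aᶜ ((LinearMap.ker p).map (toRLoc k n A)) := by
    rw [hkermap, sat_finset_sup (isLocal_rLoc _), injSub_eq_sup]
    exact Finset.sup_congr rfl fun i hi => by rw [sat_sat_union, erase_union_compl hi]
  obtain ⟨l, hl⟩ := exists_factor (f := p) (g := (injSub k n A).mkQ ∘ₗ toRLoc k n A) hp (by
    intro y hy
    rw [LinearMap.mem_ker, LinearMap.comp_apply, Submodule.mkQ_apply, Submodule.Quotient.mk_eq_zero,
      hsub]
    exact le_sat _ _ ⟨y, hy, rfl⟩)
  refine ⟨l, isLocal_inj disjoint_compl_right, fun e => ?_, fun h hh => ?_⟩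
  · obtain ⟨r, rfl⟩ := Submodule.mkQ_surjective _ e
    have hr : r ∈ sat Aᶜ (sat A (polySub (k := k) (n := n))) := by
      rw [sat_sat_union, Finset.union_compl, sat_univ_polySub]
      trivial
    obtain ⟨s, hs, hr⟩ := hr
    rw [← range_toRLoc] at hr
    obtain ⟨y, hy⟩ := hr
    exact ⟨s, hs, p y, by rw [hl, ← map_smul, ← hy, LinearMap.comp_apply]⟩
  · obtain ⟨y, rfl⟩ := hp h
    rw [hl, LinearMap.comp_apply, Submodule.mkQ_apply, Submodule.Quotient.mk_eq_zero, hsub] at hh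
    obtain ⟨s, hs, z, hz, e⟩ := hh
    refine ⟨s, hs, ?_⟩
    rw [← map_smul] at e ⊢
    rw [← toRLoc_injective A e]
    exact hz

end TopCohomologyOfPoly

/-! ### Localizations of a module with variation zero -/

section Filtration

variable {k : Type u} [Field k] {n : ℕ} {M : Type v} [AddCommGroup M] [Module (Diff k n) M]

variable {F F' : Submodule (Diff k n) M} {j : ℕ} {m : Finset (Fin n) → ℕ}
  (ψ : F' →ₗ[Diff k n] (∀ A : {A : Finset (Fin n) // A.card = j},
        Fin (m A.1) → localCoh k n (Poly k n) A.1 A.1.card))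

/-- The elements of `F'` all of whose components except the one at `A` vanish. -/
def slot (A : {A : Finset (Fin n) // A.card = j}) : Submodule (Diff k n) M :=
  ((⨅ A' : {A' : {A : Finset (Fin n) // A.card = j} // A' ≠ A}, LinearMap.ker
    (LinearMap.proj A'.1 ∘ₗ ψ))).map F'.subtype

variable {ψ}

lemma dNilp_slot (hψ : ∀ a : F', ψ a = 0 → a.1 ∈ F) {A : {A : Finset (Fin n) // A.card = j}}
    {i : Fin n} (hi : i ∉ A.1) : DNilp i F (slot ψ A) := by
  rintro _ ⟨a, ha, rfl⟩
  choose b hb using fun l => dNilp_localCoh (k := k) hi (ψ a A l) trivial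
  refine ⟨Finset.univ.sup b, fun s hs => ?_⟩
  suffices h : ψ (dop (k := k) i s • a) = 0 from hψ _ h
  funext A'
  by_cases h : A' = A
  · subst h
    funext l
    rw [map_smul]
    exact (Submodule.mem_bot _).mp (hb l s ((Finset.le_sup (Finset.mem_univ l)).trans hs))
  · have h1 : ψ a A' = 0 := (Submodule.mem_iInf _).mp ha ⟨A', h⟩
    rw [map_smul, Pi.smul_apply, h1, smul_zero]
    rfl

lemma le_sup_slot (hψ : ∀ a : F', ψ a = 0 → a.1 ∈ F) (hs : Function.Surjective ψ) :
    F' ≤ F ⊔ ⨆ A, slot ψ A := by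
  classical
  intro a ha
  choose b hb using fun A => hs (Pi.single A (ψ ⟨a, ha⟩ A))
  have hbs : ∀ A, (b A).1 ∈ slot ψ A := by
    intro A
    refine ⟨b A, (Submodule.mem_iInf _).mpr fun A' => ?_, rfl⟩
    rw [LinearMap.mem_ker, LinearMap.comp_apply, hb]
    exact Pi.single_eq_of_ne A'.2 _
  have h1 : a - ∑ A, (b A).1 ∈ F := by
    have := hψ (⟨a, ha⟩ - ∑ A, b A) (by
      rw [map_sub, map_sum, Finset.sum_congr rfl fun A _ => hb A, Finset.univ_sum_single, sub_self])
    simpa using this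
  have h2 : ∑ A, (b A).1 ∈ ⨆ A, slot ψ A :=
    sum_mem fun A _ => Submodule.mem_iSup_of_mem A (hbs A)
  rw [← sub_add_cancel a (∑ A, (b A).1)]
  exact Submodule.add_mem_sup h1 h2

lemma sat_iSup_le {N : Type*} [AddCommGroup N] [Module (Diff k n) N] {B : Finset (Fin n)}
    (h : IsLocal k B N) {ι : Type*} [Fintype ι] (U : ι → Submodule (Diff k n) N) :
    sat B (⨆ c, U c) = ⨆ c, sat B (U c) := by
  rw [← Finset.sup_univ_eq_iSup, ← Finset.sup_univ_eq_iSup, sat_finset_sup h]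

/-- If `|A'| = j < |A|`, some `i ∈ A` lies outside `A'`. The summand for `A'` is nilpotent for `∂ᵢ`,
and stays so because `xᵢ` is not among the inverted variables. -/
lemma socleFree_step (hψ : ∀ a : F', ψ a = 0 → a.1 ∈ F) (hs : Function.Surjective ψ)
    {N : Type*} [AddCommGroup N] [Module (Diff k n) N] (f : M →ₗ[Diff k n] N) {A : Finset (Fin n)}
    (hN : IsLocal k Aᶜ N) (hj : j < A.card) :
    SocleFree (sat Aᶜ (F.map f)) (sat Aᶜ (F'.map f)) := by
  have h1 : F'.map f ≤ F.map f ⊔ ⨆ A, (slot ψ A).map f := by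
    rw [← Submodule.map_iSup, ← Submodule.map_sup]
    exact Submodule.map_mono (le_sup_slot hψ hs)
  have h2 := sat_mono Aᶜ h1
  rw [sat_sup hN, sat_iSup_le hN] at h2
  refine SocleFree.mono (SocleFree.sup (fun B hB a ha _ => hB ha) (SocleFree.iSup fun A' => ?_))
    le_rfl h2
  obtain ⟨i, hi, hi'⟩ := Finset.exists_mem_notMem_of_card_lt_card (A'.2.symm ▸ hj)
  exact (((dNilp_slot hψ hi').map f).sat (by simpa using hi)).socleFree

/-- If `|A'| = j > |A|`, some `i ∈ A'` lies outside `A`. The summand for `A'` is `xᵢ`-power torsion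
and `xᵢ` is inverted, so this layer of the filtration localizes to zero. -/
lemma le_sat_of_card_lt (hψ : ∀ a : F', ψ a = 0 → a.1 ∈ F) {A : Finset (Fin n)}
    (hj : A.card < j) : F' ≤ sat Aᶜ F := by
  intro a ha
  obtain ⟨s, hs, h⟩ := exists_monoms_forall_smul_eq_zero (B := Aᶜ) (ψ ⟨a, ha⟩) fun A' =>
    exists_monoms_forall_smul_eq_zero (B := Aᶜ) (ψ ⟨a, ha⟩ A') fun l => by
      obtain ⟨i, hi, hi'⟩ := Finset.exists_mem_notMem_of_card_lt_card (A'.2.symm ▸ hj)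
      obtain ⟨t, ht⟩ := exists_xop_pow_smul_localCoh_eq_zero hi (ψ ⟨a, ha⟩ A' l)
      exact ⟨_, pow_mem (xop_mem_monoms (by simpa using hi')) t, ht⟩
  exact ⟨s, hs, hψ (s • ⟨a, ha⟩) (by rw [map_smul, h])⟩

end Filtration

/-! ### Maps from localizations of `M` to powers of `E_A` and to `E_1`. -/

section VariationZero

variable {k : Type u} [Field k] {n : ℕ} {M : Type v} [AddCommGroup M] [Module (Diff k n) M]

/-- The localization `M_{x^{1-A}}` maps onto a finite power of `E_A` with a kernel without
torsion subquotients. -/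
lemma exists_loc_to_inj (hM : IsVariationZero k n M) (A : Finset (Fin n)) :
    ∃ (r : ℕ) (f : Loc k n M Aᶜ →ₗ[Diff k n] (Fin r → Inj k n A)),
      Function.Surjective f ∧ SocleFree ⊥ (LinearMap.ker f) := by
  obtain ⟨F, m, hmono, h0, htop, hiso⟩ := hM
  have hψ : ∀ j ≤ n, ∃ ψ : F (j + 1) →ₗ[Diff k n] (∀ A : {A : Finset (Fin n) // A.card = j},
        Fin (m A.1) → localCoh k n (Poly k n) A.1 A.1.card),
      Function.Surjective ψ ∧ ∀ a, ψ a = 0 → a.1 ∈ F j := by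
    intro j hj
    obtain ⟨e⟩ := hiso j hj
    refine ⟨e.toLinearMap ∘ₗ Submodule.mkQ _, e.surjective.comp (Submodule.mkQ_surjective _), ?_⟩
    intro a ha
    rw [LinearMap.comp_apply, LinearEquiv.coe_coe, LinearEquiv.map_eq_zero_iff,
      Submodule.mkQ_apply, Submodule.Quotient.mk_eq_zero] at ha
    exact ha
  choose! ψ hsurj hker using hψ
  have hA : A.card ≤ n := by simpa using A.card_le_univ
  have hloc := isLoc_locMap (k := k) (M := M) Aᶜ
  set ι := locMap k n M Aᶜ with hι
  -- The index is shifted by one, so this concerns the layers of degree less than `|A|`. It matters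
  -- that they sit at the bottom of the filtration: they end up in the kernel of `f`.
  have hlow : ∀ j ≤ A.card, SocleFree ⊥ (sat Aᶜ ((F j).map ι)) := by
    intro j
    induction j with
    | zero =>
      intro _
      rw [h0, Submodule.map_bot, hloc.isLocal.sat_bot]
      exact SocleFree.bot _
    | succ j ih =>
      intro hj
      exact (ih (by omega)).trans
        (socleFree_step (hker j (by omega)) (hsurj j (by omega)) ι hloc.isLocal hj)
  have hhigh : ∀ d, A.card + 1 + d ≤ n + 1 → F (A.card + 1 + d) ≤ sat Aᶜ (F (A.card + 1)) := by
    intro d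
    induction d with
    | zero => exact fun _ => le_sat _ _
    | succ d ih =>
      intro hd
      have h1 := le_sat_of_card_lt (hker (A.card + 1 + d) (by omega)) (A := A) (by omega)
      refine h1.trans ((sat_mono _ (ih (by omega))).trans ?_)
      rw [sat_sat_union, Finset.union_self]
  have hall : ∀ a, a ∈ sat Aᶜ (F (A.card + 1)) := by
    intro a
    refine hhigh (n - A.card) (by omega) ?_
    rw [show A.card + 1 + (n - A.card) = n + 1 by omega, htop]
    trivial
  -- The layers above degree `|A|` vanish after localization, so the step `F (A.card + 1)` already
  -- localizes to all of `M_{x^{1-A}}`, and `f` may be defined from its top layer.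
  have hloc' : IsLoc Aᶜ (ι ∘ₗ (F (A.card + 1)).subtype) := by
    refine ⟨hloc.isLocal, fun y => ?_, fun a ha => ?_⟩
    · obtain ⟨s, hs, a, ha⟩ := hloc.surj y
      obtain ⟨t, ht, hta⟩ := hall a
      exact ⟨t * s, mul_mem ht hs, ⟨_, hta⟩, by
        rw [mul_smul, ha, ← map_smul]; rfl⟩
    · obtain ⟨s, hs, h⟩ := hloc.ker a.1 ha
      exact ⟨s, hs, Subtype.ext h⟩
  obtain ⟨l, hl⟩ := exists_isLoc_localCoh_inj (k := k) A
  have hL := hl.compLeft (Fin (m A))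
  let A₀ : {B : Finset (Fin n) // B.card = A.card} := ⟨A, rfl⟩
  let g : F (A.card + 1) →ₗ[Diff k n] (Fin (m A) → Inj k n A) :=
    l.compLeft (Fin (m A)) ∘ₗ LinearMap.proj A₀ ∘ₗ ψ A.card
  obtain ⟨f, hf⟩ := hloc'.exists_lift hL.isLocal g
  refine ⟨m A, f, fun e => ?_, (hlow A.card le_rfl).mono le_rfl fun y hy => ?_⟩
  · obtain ⟨s, hs, h, hh⟩ := hL.surj e
    obtain ⟨a, ha⟩ := hsurj A.card hA (Pi.single (M := fun B : {B : Finset (Fin n) //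
      B.card = A.card} => Fin (m B.1) → localCoh k n (Poly k n) B.1 B.1.card) A₀ h)
    obtain ⟨z, hz⟩ := (hloc.isLocal s hs).2 (ι a.1)
    refine ⟨z, hL.isLocal.smul_cancel hs ?_⟩
    have hg : f (ι a.1) = g a := hf a
    dsimp only at hz
    rw [← map_smul, hz, hg, hh, LinearMap.comp_apply, LinearMap.comp_apply, ha]
    exact congrArg _ (Pi.single_eq_same _ _)
  · obtain ⟨t, ht, a, ha⟩ := hloc'.surj y
    have hga : g a = 0 := by rw [← hf a, ← ha, map_smul, LinearMap.mem_ker.mp hy, smul_zero]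
    -- The component at `A` is killed by a monomial since it dies in a power of `E_A`. Any other `B`
    -- of the same cardinality contains an index outside `A`, so its component is torsion for an
    -- inverted variable.
    obtain ⟨s, hs, h⟩ := exists_monoms_forall_smul_eq_zero (B := Aᶜ) (ψ A.card a) fun B => by
      by_cases hB : B = A₀
      · subst hB
        exact hL.ker _ hga
      · refine exists_monoms_forall_smul_eq_zero (B := Aᶜ) (ψ A.card a B) fun c => ?_
        obtain ⟨i, hi, hi'⟩ : ∃ i ∈ B.1, i ∉ A := by
          by_contra! hsub
          exact hB (Subtype.ext (Finset.eq_of_subset_of_card_le hsub B.2.ge))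
        obtain ⟨t, ht⟩ := exists_xop_pow_smul_localCoh_eq_zero hi (ψ A.card a B c)
        exact ⟨_, pow_mem (xop_mem_monoms (by simpa using hi')) t, ht⟩
    refine ⟨s * t, mul_mem hs ht, s • a.1, hker A.card hA (s • a) (by rw [map_smul, h]), ?_⟩
    rw [mul_smul, ha, map_smul]
    rfl

/-- A map from a submodule of `N` to `E_1` extends to `N`. -/
def ExtendsToInj (N : Type*) [AddCommGroup N] [Module (Diff k n) N] : Prop :=
  ∀ (Q : Submodule (Diff k n) N) (f : Q →ₗ[Diff k n] Inj k n Finset.univ),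
    ∃ g : N →ₗ[Diff k n] Inj k n Finset.univ, ∀ y : Q, g y = f y

lemma SocleFree.pi {ι : Type*} [Fintype ι] {X : ι → Type*} [∀ c, AddCommGroup (X c)]
    [∀ c, Module (Diff k n) (X c)] {U : ∀ c, Submodule (Diff k n) (X c)}
    (h : ∀ c, SocleFree ⊥ (U c)) : SocleFree ⊥ (Submodule.pi Set.univ U) := by
  classical
  have h1 : SocleFree ⊥ (⨆ c, (U c).map (LinearMap.single (Diff k n) X c)) :=
    SocleFree.iSup fun c => ((h c).map _).mono (by rw [Submodule.map_bot]) le_rfl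
  refine h1.mono le_rfl fun y hy => ?_
  rw [← Finset.univ_sum_single y]
  exact sum_mem fun c _ => Submodule.mem_iSup_of_mem c ⟨y c, hy c trivial, rfl⟩

lemma extendsToInj_of_socleFree_ker {N S : Type*} [AddCommGroup N] [Module (Diff k n) N]
    [AddCommGroup S] [Module (Diff k n) S] [IsSemisimpleModule (Diff k n) S]
    (φ : N →ₗ[Diff k n] S) (h : SocleFree ⊥ (LinearMap.ker φ)) :
    ExtendsToInj (k := k) (n := n) N := by
  intro Q f
  -- The kernel of `f`, viewed in `N`, contains a multiple of `y` by a power of each variable, as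
  -- `E_1` is torsion. Hence `f` factors through `φ(Q)`, which is a direct summand of the semisimple
  -- module `S`.
  have hker : ∀ y : Q, φ y = 0 → f y = 0 := by
    intro y hy
    have hB : y.1 ∈ (LinearMap.ker f).map Q.subtype := by
      refine mem_of_forall_xop_pow_smul_mem
        (h ((LinearMap.ker f).map Q.subtype) bot_le) (LinearMap.mem_ker.mpr hy) fun i => ?_
      obtain ⟨t, ht⟩ := isTorsion_inj (f y) i
      exact ⟨t, xop i ^ t • y, by rw [SetLike.mem_coe, LinearMap.mem_ker, map_smul, ht], rfl⟩
    obtain ⟨z, hz, e⟩ := hB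
    have : z = y := Subtype.ext e
    exact this ▸ LinearMap.mem_ker.mp hz
  let Q' := LinearMap.range (φ ∘ₗ Q.subtype)
  obtain ⟨f', hf'⟩ := exists_factor (f := (φ ∘ₗ Q.subtype).rangeRestrict) (g := f)
    (LinearMap.surjective_rangeRestrict _) (by
      intro y hy
      exact hker y (congrArg Subtype.val (LinearMap.mem_ker.mp hy)))
  obtain ⟨C, hC⟩ := exists_isCompl Q'
  refine ⟨f' ∘ₗ (Q'.projectionOnto C hC) ∘ₗ φ, fun y => ?_⟩
  have h1 : (Q'.projectionOnto C hC) (φ y) = (φ ∘ₗ Q.subtype).rangeRestrict y :=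
    Submodule.projectionOnto_apply_left hC ((φ ∘ₗ Q.subtype).rangeRestrict y)
  rw [LinearMap.comp_apply, LinearMap.comp_apply, h1, hf']

/-- Compose the map onto a power of `E_{Aᶜ}` with `E_{Aᶜ} → E_1`. The new part of the kernel comes
from `injSub`, which has no torsion subquotients. -/
lemma exists_loc_to_semisimple (hM : IsVariationZero k n M) (A : Finset (Fin n)) :
    ∃ (r : ℕ) (f : Loc k n M A →ₗ[Diff k n] (Fin r → Inj k n Finset.univ)),
      SocleFree ⊥ (LinearMap.ker f) := by
  have hA := exists_loc_to_inj hM Aᶜ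
  rw [compl_compl] at hA
  obtain ⟨r, f, hf, hker⟩ := hA
  refine ⟨r, (injMap k (Finset.subset_univ Aᶜ)).compLeft (Fin r) ∘ₗ f, ?_⟩
  have hK : SocleFree ⊥ (LinearMap.ker (injMap k (Finset.subset_univ Aᶜ))) := by
    rw [ker_injMap]
    exact ((socleFree_injSub Finset.univ).map _).mono (by rw [Submodule.map_bot]) le_rfl
  have hpi := (SocleFree.pi (ι := Fin r) fun _ => hK).comap hf
  refine hker.trans ?_
  refine hpi.mono (by rw [← LinearMap.ker]) ?_
  intro y hy l _
  exact congrFun (LinearMap.mem_ker.mp hy) l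

lemma extendsToInj_cech (hM : IsVariationZero k n M) (p : ℕ) :
    ExtendsToInj (k := k) (n := n) ((cech k n M Finset.univ).X p) := by
  choose r f hf using exists_loc_to_semisimple hM
  let φ : (∀ B : {B : Finset (Fin n) // B ⊆ Finset.univ ∧ B.card = p}, Loc k n M B.1) →ₗ[Diff k n]
      (∀ B : {B : Finset (Fin n) // B ⊆ Finset.univ ∧ B.card = p},
        Fin (r B.1) → Inj k n Finset.univ) :=
    LinearMap.pi fun B => f B.1 ∘ₗ LinearMap.proj B
  refine extendsToInj_of_socleFree_ker (N := ∀ B : {B : Finset (Fin n) // B ⊆ Finset.univ ∧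
    B.card = p}, Loc k n M B.1) φ ?_
  refine (SocleFree.pi (ι := {B : Finset (Fin n) // B ⊆ Finset.univ ∧ B.card = p})
    (X := fun B => Loc k n M B.1) fun B => hf B.1).mono le_rfl ?_
  intro y hy B _
  exact congrFun (LinearMap.mem_ker.mp hy) B

/-- A map `M_{x^{1-A}} → E_1` lifts to `E_A`. -/
lemma exists_lift_injMap (hM : IsVariationZero k n M) (A : Finset (Fin n))
    (h : Loc k n M Aᶜ →ₗ[Diff k n] Inj k n Finset.univ) :
    ∃ g : Loc k n M Aᶜ →ₗ[Diff k n] Inj k n A,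
      ∀ y, injMap k (Finset.subset_univ A) (g y) = h y := by
  classical
  obtain ⟨r, f, hf, hker⟩ := exists_loc_to_inj hM A
  obtain ⟨h', hh'⟩ := exists_factor (f := f) (g := h) hf fun y hy =>
    LinearMap.mem_ker.mpr (hker.map_eq_zero isTorsion_inj h bot_le hy)
  -- Each component, pulled back to `R_{x^1}`, is a scalar multiple of the canonical epimorphism;
  -- the same scalars then define the lift to `E_A`.
  have hc : ∀ l : Fin r, ∃ c : k, ∀ e : Inj k n A, h' (Pi.single l e) =
      c • injMap k (Finset.subset_univ A) e := by
    intro l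
    obtain ⟨c, hc⟩ := exists_eq_smul_mkQ
      (h' ∘ₗ LinearMap.single (Diff k n) (fun _ : Fin r => Inj k n A) l ∘ₗ (injSub k n A).mkQ)
    refine ⟨c, fun e => ?_⟩
    obtain ⟨y, rfl⟩ := Submodule.mkQ_surjective _ e
    exact hc y
  choose c hc using hc
  refine ⟨(∑ l, c l • LinearMap.proj l) ∘ₗ f, fun y => ?_⟩
  rw [← hh' y, ← Finset.univ_sum_single (f y), map_sum, Finset.sum_congr rfl fun l _ => hc l _,
    LinearMap.comp_apply, LinearMap.sum_apply, map_sum]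
  refine Finset.sum_congr rfl fun l _ => ?_
  rw [LinearMap.smul_apply, LinearMap.proj_apply]
  exact LinearMap.map_smul_of_tower (injMap k (Finset.subset_univ A)) (c l) (f y l)

end VariationZero

/-! ### Comparison of the hypercube with the Čech complex -/

section Comparison

variable {k : Type u} [Field k] {n : ℕ} {M : Type v} [AddCommGroup M] [Module (Diff k n) M]

lemma bijective_precomp_locMap (A : Finset (Fin n)) : Function.Bijective
    (precomp (k := k) (Inj k n A) (locMap k n M Aᶜ)) := by
  have hl : IsLocal k Aᶜ (Inj k n A) := isLocal_inj disjoint_compl_right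
  constructor
  · intro g g' e
    exact (isLoc_locMap Aᶜ).hom_ext hl fun m => congrArg (fun φ => φ m) e
  · intro g
    obtain ⟨h, hh⟩ := (isLoc_locMap Aᶜ).exists_lift hl g
    exact ⟨h, LinearMap.ext hh⟩

lemma bijective_postcomp_injMap (hM : IsVariationZero k n M) (A : Finset (Fin n)) :
    Function.Bijective (postcomp (k := k) (Loc k n M Aᶜ) (injMap k (Finset.subset_univ A))) := by
  constructor
  · refine (injective_iff_map_eq_zero _).mpr fun g hg => ?_
    refine eq_zero_of_injMap_comp_eq_zero (isLoc_locMap Aᶜ).isLocal (Finset.subset_univ A)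
      (by rw [Finset.union_compl]) g fun y => ?_
    exact congrArg (fun φ => φ y) hg
  · intro h
    obtain ⟨g, hg⟩ := exists_lift_injMap hM A h
    exact ⟨g, LinearMap.ext hg⟩

/-- The isomorphism `[M]_A ≅ [M_{x^{1-A}}]_1`. -/
def vertexEquiv (hM : IsVariationZero k n M) (A : Finset (Fin n)) :
    (M →ₗ[Diff k n] Inj k n A) ≃ₗ[k] (Loc k n M Aᶜ →ₗ[Diff k n] Inj k n Finset.univ) :=
  (LinearEquiv.ofBijective _ (bijective_precomp_locMap A)).symm ≪≫ₗ
    LinearEquiv.ofBijective _ (bijective_postcomp_injMap hM A)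

lemma vertexEquiv_comp_locMap (hM : IsVariationZero k n M) (A : Finset (Fin n))
    (g : Loc k n M Aᶜ →ₗ[Diff k n] Inj k n A) :
    vertexEquiv hM A (g ∘ₗ locMap k n M Aᶜ) = injMap k (Finset.subset_univ A) ∘ₗ g := by
  have h : (LinearEquiv.ofBijective _ (bijective_precomp_locMap (k := k) (M := M) A)).symm
      (g ∘ₗ locMap k n M Aᶜ) = g := by
    rw [LinearEquiv.symm_apply_eq]
    rfl
  rw [vertexEquiv, LinearEquiv.trans_apply, h]
  rfl

/-- Extending `g` to `g'` on `M_{x^{1-A'}}`, the map `injMap ∘ g' ∘ oreMap` extends `injMap ∘ g` to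
`M_{x^{1-A}}`, so it computes the left side. -/
lemma vertexEquiv_naturality (hM : IsVariationZero k n M) {A A' : Finset (Fin n)} (h : A' ⊆ A)
    (g : M →ₗ[Diff k n] Inj k n A') :
    vertexEquiv hM A (injMap k h ∘ₗ g) = vertexEquiv hM A' g ∘ₗ
      oreMap M (monoms_mono k n (Finset.compl_subset_compl.mpr h)) := by
  obtain ⟨g', rfl⟩ := (bijective_precomp_locMap (k := k) (M := M) A').2 g
  have h1 : precomp (k := k) (Inj k n A') (locMap k n M A'ᶜ) g' = g' ∘ₗ locMap k n M A'ᶜ := rfl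
  have h2 : injMap k h ∘ₗ g' ∘ₗ locMap k n M A'ᶜ =
      (injMap k h ∘ₗ g' ∘ₗ oreMap M (monoms_mono k n (Finset.compl_subset_compl.mpr h))) ∘ₗ
        locMap k n M Aᶜ := rfl
  rw [h1, vertexEquiv_comp_locMap, h2, vertexEquiv_comp_locMap]
  refine LinearMap.ext fun y => ?_
  rw [LinearMap.comp_apply, LinearMap.comp_apply, injMap_comp]
  rfl

/-- The sign relating the orientations of the hypercube at `A` and of the Čech complex at `Aᶜ`. -/
def compSign (A : Finset (Fin n)) : ℤ := ∏ i ∈ A, (-1) ^ (i : ℕ)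

lemma compSign_mul_self (A : Finset (Fin n)) : compSign A * compSign A = 1 := by
  rw [compSign, ← Finset.prod_mul_distrib]
  exact Finset.prod_eq_one fun i _ => by rw [← mul_pow]; simp

/-- The elements below `i` in `A` and in the complement of `A.erase i` together are all `i` elements
below `i`. The two signs therefore differ by `(-1)^i`, the factor that `i` contributes to `compSign
A`. -/
lemma compSign_mul_sgn {A : Finset (Fin n)} {i : Fin n} (hi : i ∈ A) :
    compSign A * sgn i A = compSign (A.erase i) * sgn i (A.erase i)ᶜ := by
  have h1 : (A.filter (· < i)).card + ((A.erase i)ᶜ.filter (· < i)).card = i := by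
    have h2 : (A.erase i)ᶜ.filter (· < i) = (Finset.univ.filter (· < i)) \ A.filter (· < i) := by
      ext j
      simp only [Finset.mem_filter, Finset.mem_compl, Finset.mem_erase, Finset.mem_sdiff,
        Finset.mem_univ, true_and]
      constructor
      · rintro ⟨h, h'⟩
        exact ⟨h', fun hj => h ⟨h'.ne, hj.1⟩⟩
      · rintro ⟨h, h'⟩
        exact ⟨fun hj => h' ⟨hj.2, h⟩, h⟩
    have h3 : A.filter (· < i) ⊆ Finset.univ.filter (· < i) :=
      Finset.filter_subset_filter _ (Finset.subset_univ A)
    rw [h2, Finset.card_sdiff_of_subset h3, Nat.add_sub_cancel' (Finset.card_le_card h3)]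
    have h6 : Finset.univ.filter (· < i) = Finset.Iio i := by ext; simp
    rw [h6, Fin.card_Iio]
  have h4 : compSign A = (-1) ^ (i : ℕ) * compSign (A.erase i) :=
    (Finset.mul_prod_erase A (fun i => (-1 : ℤ) ^ (i : ℕ)) hi).symm
  have h5 : ((-1 : ℤ) ^ (A.filter (· < i)).card) * (-1) ^ (A.filter (· < i)).card = 1 := by
    rw [← mul_pow]; simp
  rw [h4, sgn, sgn]
  nth_rewrite 1 [← h1]
  rw [pow_add]
  linear_combination (compSign (A.erase i) * (-1) ^ ((A.erase i)ᶜ.filter (· < i)).card) * h5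

/-- The index in the Čech complex complementary to an index in the hypercube complex. -/
def complIdx {p : ℕ} (A : {A : Finset (Fin n) // A.card + p = n}) :
    {B : Finset (Fin n) // B ⊆ Finset.univ ∧ B.card = p} :=
  ⟨A.1ᶜ, Finset.subset_univ _, by
    have := A.2
    rw [Finset.card_compl, Fintype.card_fin]
    omega⟩

lemma complIdx_surjective {p : ℕ} (B : {B : Finset (Fin n) // B ⊆ Finset.univ ∧ B.card = p}) :
    ∃ A, complIdx A = B := by
  refine ⟨⟨B.1ᶜ, ?_⟩, Subtype.ext (compl_compl _)⟩
  have := B.2.2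
  have := B.1.card_le_univ
  rw [Fintype.card_fin] at this
  rw [Finset.card_compl, Fintype.card_fin]
  omega

lemma complIdx_injective {p : ℕ} : Function.Injective (complIdx (n := n) (p := p)) :=
  fun _ _ e => Subtype.ext (compl_injective (congrArg Subtype.val e))

/-- The comparison map from the hypercube complex to the dual of the Čech complex in degree `p`. -/
def compMap (hM : IsVariationZero k n M) (p : ℕ) :
    (∀ A : {A : Finset (Fin n) // A.card + p = n}, M →ₗ[Diff k n] Inj k n A.1) →ₗ[k]
      ((∀ B : {B : Finset (Fin n) // B ⊆ Finset.univ ∧ B.card = p}, Loc k n M B.1) →ₗ[Diff k n]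
        Inj k n Finset.univ) :=
  ∑ A : {A : Finset (Fin n) // A.card + p = n}, compSign A.1 •
    (precomp (k := k) (Inj k n Finset.univ) (LinearMap.proj (complIdx A)) ∘ₗ
      (vertexEquiv hM A.1).toLinearMap ∘ₗ LinearMap.proj A)

lemma compMap_apply (hM : IsVariationZero k n M) (p : ℕ)
    (w : ∀ A : {A : Finset (Fin n) // A.card + p = n}, M →ₗ[Diff k n] Inj k n A.1)
    (z : ∀ B : {B : Finset (Fin n) // B ⊆ Finset.univ ∧ B.card = p}, Loc k n M B.1) :
    compMap hM p w z = ∑ A : {A : Finset (Fin n) // A.card + p = n},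
      compSign A.1 • vertexEquiv hM A.1 (w A) (z (complIdx A)) := by
  rw [compMap, LinearMap.sum_apply, LinearMap.sum_apply]
  rfl

lemma compMap_single (hM : IsVariationZero k n M) (p : ℕ)
    (w : ∀ A : {A : Finset (Fin n) // A.card + p = n}, M →ₗ[Diff k n] Inj k n A.1)
    (A : {A : Finset (Fin n) // A.card + p = n}) (y : Loc k n M A.1ᶜ) :
    compMap hM p w (Pi.single (M := fun B : {B : Finset (Fin n) // B ⊆ Finset.univ ∧ B.card = p} =>
      Loc k n M B.1) (complIdx A) y) = compSign A.1 • vertexEquiv hM A.1 (w A) y := by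
  rw [compMap_apply, Finset.sum_eq_single A]
  · exact congrArg (fun e => compSign A.1 • vertexEquiv hM A.1 (w A) e)
      (Pi.single_eq_same (M := fun B : {B : Finset (Fin n) // B ⊆ Finset.univ ∧ B.card = p} =>
        Loc k n M B.1) (complIdx A) y)
  · intro A' _ hA'
    refine (congrArg (fun e => compSign A'.1 • vertexEquiv hM A'.1 (w A') e)
      (Pi.single_eq_of_ne (M := fun B : {B : Finset (Fin n) // B ⊆ Finset.univ ∧ B.card = p} =>
        Loc k n M B.1) (fun e => hA' (complIdx_injective e)) y)).trans ?_
    exact (congrArg (fun e => compSign A'.1 • e) (map_zero (vertexEquiv hM A'.1 (w A')))).trans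
      (smul_zero _)
  · intro h
    exact absurd (Finset.mem_univ A) h

lemma compMap_bijective (hM : IsVariationZero k n M) (p : ℕ) :
    Function.Bijective (compMap hM p) := by
  constructor
  · refine (injective_iff_map_eq_zero _).mpr fun w hw => funext fun A => ?_
    rw [Pi.zero_apply, ← (vertexEquiv hM A.1).map_eq_zero_iff]
    refine LinearMap.ext fun y => ?_
    have h := compMap_single hM p w A y
    rw [hw, LinearMap.zero_apply] at h
    have h' := congrArg (fun e => compSign A.1 • e) h
    simp only [smul_smul, compSign_mul_self, one_smul, smul_zero] at h'
    exact h'.symm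
  · intro f
    refine ⟨fun A => (vertexEquiv hM A.1).symm (compSign A.1 • f ∘ₗ LinearMap.single (Diff k n)
      (fun B : {B : Finset (Fin n) // B ⊆ Finset.univ ∧ B.card = p} => Loc k n M B.1)
        (complIdx A)), ?_⟩
    refine LinearMap.pi_ext fun B y => ?_
    obtain ⟨A, rfl⟩ := complIdx_surjective B
    refine (compMap_single hM p _ A y).trans ?_
    refine (congrArg (fun φ => compSign A.1 • (φ : Loc k n M A.1ᶜ →ₗ[Diff k n] _) y)
      (LinearEquiv.apply_symm_apply (vertexEquiv hM A.1) _)).trans ?_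
    refine (smul_smul (compSign A.1) (compSign A.1) (f (Pi.single (complIdx A) y))).trans ?_
    rw [compSign_mul_self, one_smul]

lemma zsmul_map_sum_zsmul {X Y ι : Type*} [AddCommGroup X] [AddCommGroup Y] (φ : X →+ Y) (c : ℤ)
    (t : Finset ι) (s : ι → ℤ) (x : ι → X) :
    c • φ (∑ i ∈ t, s i • x i) = ∑ i ∈ t, (c * s i) • φ (x i) := by
  rw [map_sum, Finset.smul_sum]
  exact Finset.sum_congr rfl fun i _ => by rw [map_zsmul, mul_smul]

lemma cubeD_hypercube_apply {p : ℕ} (h)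
    (w : ∀ A : {A : Finset (Fin n) // A.card + (p + 1) = n}, M →ₗ[Diff k n] Inj k n A.1)
    (A : {A : Finset (Fin n) // A.card + p = n}) :
    (cubeD (hypercube k n M) (fun A => A.card + (p + 1) = n) (fun A => A.card + p = n) h w A :
      M →ₗ[Diff k n] Inj k n A.1) = ∑ i ∈ A.1.attach, sgn i.1 A.1 •
        (injMap k (A.1.erase_subset i.1) ∘ₗ w ⟨A.1.erase i.1, h A.1 A.2 i.1 i.2⟩) :=
  cubeD_apply (hypercube k n M) (fun A => A.card + (p + 1) = n) (fun A => A.card + p = n) h w A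

lemma vertexEquiv_sum_apply (hM : IsVariationZero k n M) (A : Finset (Fin n)) {ι : Type*}
    (t : Finset ι) (c : ℤ) (s : ι → ℤ) (g : ι → M →ₗ[Diff k n] Inj k n A) (y : Loc k n M Aᶜ) :
    c • vertexEquiv hM A (∑ i ∈ t, s i • g i) y =
      ∑ i ∈ t, (c * s i) • vertexEquiv hM A (g i) y :=
  zsmul_map_sum_zsmul (AddMonoidHom.mk' (fun g => vertexEquiv hM A g y)
    (fun a b => by rw [map_add]; rfl)) c t s g

/-- Both sides become sums over pairs of a set and a distinguished element. Moving that element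
between the set and its complement matches the terms, by `vertexEquiv_naturality` and
`compSign_mul_sgn`. -/
lemma compMap_comm (hM : IsVariationZero k n M) (p : ℕ)
    (w : ∀ A : {A : Finset (Fin n) // A.card + (p + 1) = n}, M →ₗ[Diff k n] Inj k n A.1)
    (z : ∀ B : {B : Finset (Fin n) // B ⊆ Finset.univ ∧ B.card = p}, Loc k n M B.1) :
    compMap hM (p + 1) w (cubeD (locCube k n M) (fun B => B ⊆ Finset.univ ∧ B.card = p)
      (fun B => B ⊆ Finset.univ ∧ B.card = p + 1)
      (fun C hC i hi => ⟨(C.erase_subset i).trans hC.1, by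
        rw [Finset.card_erase_of_mem hi, hC.2, Nat.add_sub_cancel]⟩) z) =
    compMap hM p (cubeD (hypercube k n M) (fun A => A.card + (p + 1) = n)
      (fun A => A.card + p = n)
      (fun C hC i hi => by have := Finset.card_erase_add_one hi; omega) w) z := by
  let G : ∀ (A : {A : Finset (Fin n) // A.card + (p + 1) = n})
      (B : {B : Finset (Fin n) // B ⊆ Finset.univ ∧ B.card = p}), B.1 ⊆ A.1ᶜ →
      Inj k n Finset.univ :=
    fun A B h => vertexEquiv hM A.1 (w A) (oreMap M (monoms_mono k n h) (z B))
  have hG : ∀ A A' B B' h h', A = A' → B = B' → G A B h = G A' B' h' := by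
    rintro A _ B _ h h' rfl rfl
    rfl
  have hL : compMap hM (p + 1) w (cubeD (locCube k n M) (fun B => B ⊆ Finset.univ ∧ B.card = p)
      (fun B => B ⊆ Finset.univ ∧ B.card = p + 1)
      (fun C hC i hi => ⟨(C.erase_subset i).trans hC.1, by
        rw [Finset.card_erase_of_mem hi, hC.2, Nat.add_sub_cancel]⟩) z) =
      ∑ A : {A : Finset (Fin n) // A.card + (p + 1) = n}, ∑ i ∈ A.1ᶜ.attach,
        (compSign A.1 * sgn i.1 A.1ᶜ) • G A ⟨A.1ᶜ.erase i.1, Finset.subset_univ _, by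
          have : A.1ᶜ.card = p + 1 := (complIdx A).2.2
          rw [Finset.card_erase_of_mem i.2, this, Nat.add_sub_cancel]⟩
          (Finset.erase_subset _ _) := by
    refine (compMap_apply hM (p + 1) w _).trans (Finset.sum_congr rfl fun A _ => ?_)
    refine (congrArg (fun e => compSign A.1 • vertexEquiv hM A.1 (w A) e)
      (cubeD_apply _ _ _ _ _ _)).trans ?_
    exact zsmul_map_sum_zsmul (vertexEquiv hM A.1 (w A)).toAddMonoidHom _ _ _ _
  have hR : compMap hM p (cubeD (hypercube k n M) (fun A => A.card + (p + 1) = n)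
      (fun A => A.card + p = n)
      (fun C hC i hi => by have := Finset.card_erase_add_one hi; omega) w) z =
      ∑ A : {A : Finset (Fin n) // A.card + p = n}, ∑ i ∈ A.1.attach,
        (compSign A.1 * sgn i.1 A.1) • G ⟨A.1.erase i.1, by
          have := A.2; have := Finset.card_erase_add_one i.2; omega⟩ (complIdx A)
          (Finset.compl_subset_compl.mpr (Finset.erase_subset _ _)) := by
    refine (compMap_apply hM p _ z).trans (Finset.sum_congr rfl fun A _ => ?_)
    refine (congrArg (fun e => compSign A.1 • vertexEquiv hM A.1 e (z (complIdx A)))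
      (cubeD_hypercube_apply _ w A)).trans ?_
    refine (vertexEquiv_sum_apply hM A.1 _ _ _ _ _).trans (Finset.sum_congr rfl fun i _ => ?_)
    rw [vertexEquiv_naturality]
    rfl
  rw [hL, hR, Finset.sum_sigma', Finset.sum_sigma']
  have ext1 : ∀ q : ℕ, ∀ x y : (Σ A : {A : Finset (Fin n) // A.card + q = n},
      {i // i ∈ A.1}), x.1.1 = y.1.1 → x.2.1 = y.2.1 → x = y := by
    rintro q ⟨⟨A, hA⟩, ⟨i, hi⟩⟩ ⟨⟨A', hA'⟩, ⟨j, hj⟩⟩ h h'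
    dsimp only at h h'
    subst h h'
    rfl
  have ext2 : ∀ q : ℕ, ∀ x y : (Σ A : {A : Finset (Fin n) // A.card + q = n},
      {i // i ∈ A.1ᶜ}), x.1.1 = y.1.1 → x.2.1 = y.2.1 → x = y := by
    rintro q ⟨⟨A, hA⟩, ⟨i, hi⟩⟩ ⟨⟨A', hA'⟩, ⟨j, hj⟩⟩ h h'
    dsimp only at h h'
    subst h h'
    rfl
  refine Finset.sum_bij'
    (fun x _ => ⟨⟨insert x.2.1 x.1.1, by
      have := x.1.2
      rw [Finset.card_insert_of_notMem (Finset.mem_compl.mp x.2.2)]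
      omega⟩, ⟨x.2.1, Finset.mem_insert_self _ _⟩⟩)
    (fun x _ => ⟨⟨x.1.1.erase x.2.1, by
      have := x.1.2; have := Finset.card_erase_add_one x.2.2; omega⟩, ⟨x.2.1, by simp⟩⟩)
    ?_ ?_ ?_ ?_ ?_
  · intros; simp
  · intros; simp
  · rintro ⟨A, i, hi⟩ _
    exact ext2 _ _ _ (Finset.erase_insert (Finset.mem_compl.mp hi)) rfl
  · rintro ⟨A, i, hi⟩ _
    exact ext1 _ _ _ (Finset.insert_erase hi) rfl
  · rintro ⟨A, i, hi⟩ _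
    have hi' := Finset.mem_compl.mp hi
    have he : (insert i A.1).erase i = A.1 := Finset.erase_insert hi'
    dsimp only
    have hs := compSign_mul_sgn (Finset.mem_insert_self i A.1)
    rw [he] at hs
    rw [hs]
    congr 1
    refine hG _ _ _ _ (Finset.erase_subset _ _)
      (Finset.compl_subset_compl.mpr (Finset.erase_subset _ _)) (Subtype.ext he.symm) (Subtype.ext ?_)
    change A.1ᶜ.erase i = (insert i A.1)ᶜ
    rw [Finset.compl_insert]

lemma hypercubeComplex_d (p : ℕ) : (hypercubeComplex k n M).d (p + 1) p =
    ModuleCat.ofHom (cubeD (hypercube k n M) (fun A => A.card + (p + 1) = n)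
      (fun A => A.card + p = n)
      (fun C hC i hi => by have := Finset.card_erase_add_one hi; omega)) :=
  ChainComplex.of_d
    (fun p => ModuleCat.of k
      (∀ A : {A : Finset (Fin n) // A.card + p = n}, (hypercube k n M).obj A.1))
    (fun p => ModuleCat.ofHom (cubeD (hypercube k n M) (fun A => A.card + (p + 1) = n)
      (fun A => A.card + p = n)
      (fun C hC i hi => by have := Finset.card_erase_add_one hi; omega))) p

/-- The hypercube complex is the degree `1` part of the Čech complex. -/
def hypercubeComplexIso (hM : IsVariationZero k n M) :
    hypercubeComplex k n M ≅ degOne k n (cech k n M Finset.univ) :=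
  HomologicalComplex.Hom.isoOfComponents
    (fun p => (LinearEquiv.ofBijective _ (compMap_bijective hM p)).toModuleIso) (by
      rintro _ p rfl
      refine ModuleCat.hom_ext (LinearMap.ext fun w => LinearMap.ext fun z => ?_)
      have h1 := compMap_comm hM p w z
      rw [hypercubeComplex_d]
      refine Eq.trans ?_ h1
      exact congrArg (fun f => compMap hM (p + 1) w (ModuleCat.Hom.hom f z))
        (cech_d M Finset.univ p))

end Comparison

/-! ### Homology of a dual complex -/

section DualHomology

variable {k : Type u} [Field k] {D : Type u} [Ring D] [Algebra k D]

lemma exists_surjective_ker_to_homology (S : ShortComplex (ModuleCat.{v} D)) :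
    ∃ π : LinearMap.ker S.g.hom →ₗ[D] S.homology, Function.Surjective π ∧
      ∀ x, π x = 0 ↔ x.1 ∈ LinearMap.range S.f.hom := by
  let e : S.homology ≃ₗ[D] (LinearMap.ker S.g.hom ⧸ LinearMap.range S.moduleCatToCycles) :=
    S.moduleCatHomologyIso.toLinearEquiv
  refine ⟨e.symm.toLinearMap ∘ₗ Submodule.mkQ _,
    e.symm.surjective.comp (Submodule.mkQ_surjective _), fun x => ?_⟩
  rw [LinearMap.comp_apply, LinearEquiv.coe_coe, LinearEquiv.map_eq_zero_iff, Submodule.mkQ_apply,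
    Submodule.Quotient.mk_eq_zero]
  constructor
  · rintro ⟨y, rfl⟩
    exact ⟨y, rfl⟩
  · rintro ⟨y, hy⟩
    exact ⟨y, Subtype.ext hy⟩

/-- If maps to `E` extend from submodules of the terms of a complex, then the homology of the dual
complex is the dual of the homology. -/
lemma nonempty_dual_homology_equiv (S : ShortComplex (ModuleCat.{max u v} D)) (E : Type u)
    [AddCommGroup E] [Module D E] [Module k E] [IsScalarTower k D E]
    (h₂ : ∀ (Q : Submodule D S.X₂) (f : Q →ₗ[D] E), ∃ g : S.X₂ →ₗ[D] E, ∀ y : Q, g y = f y)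
    (h₃ : ∀ (Q : Submodule D S.X₃) (f : Q →ₗ[D] E), ∃ g : S.X₃ →ₗ[D] E, ∀ y : Q, g y = f y)
    (T : ShortComplex (ModuleCat.{max u v} k)) (w)
    (hT : T = ShortComplex.mk (X₁ := ModuleCat.of k (S.X₃ →ₗ[D] E))
      (X₂ := ModuleCat.of k (S.X₂ →ₗ[D] E)) (X₃ := ModuleCat.of k (S.X₁ →ₗ[D] E))
      (ModuleCat.ofHom (precomp E S.g.hom)) (ModuleCat.ofHom (precomp E S.f.hom)) w) :
    Nonempty ((S.homology →ₗ[D] E) ≃ₗ[k] T.homology) := by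
  subst hT
  set T := ShortComplex.mk (X₁ := ModuleCat.of k (S.X₃ →ₗ[D] E))
      (X₂ := ModuleCat.of k (S.X₂ →ₗ[D] E)) (X₃ := ModuleCat.of k (S.X₁ →ₗ[D] E))
      (ModuleCat.ofHom (precomp E S.g.hom)) (ModuleCat.ofHom (precomp E S.f.hom)) w
  obtain ⟨π, hπ, hπ0⟩ := exists_surjective_ker_to_homology S
  obtain ⟨ϖ, hϖ, hϖ0⟩ := exists_surjective_ker_to_homology T
  have hS : ∀ x, S.g.hom (S.f.hom x) = 0 := fun x => congrArg (fun g => g.hom x) S.zero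
  let ρ : LinearMap.ker (precomp (k := k) E S.f.hom) →ₗ[k] (LinearMap.ker S.g.hom →ₗ[D] E) :=
    precomp (k := k) E (LinearMap.ker S.g.hom).subtype ∘ₗ Submodule.subtype _
  let Ψ : (S.homology →ₗ[D] E) →ₗ[k] (LinearMap.ker S.g.hom →ₗ[D] E) := precomp E π
  have hΨ : Function.Injective Ψ := by
    intro a b e
    refine LinearMap.ext fun y => ?_
    obtain ⟨x, rfl⟩ := hπ y
    exact congrArg (fun φ => φ x) e
  -- A cocycle vanishes on the image of `S.f`, so its restriction to the cycles of `S` descends to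
  -- `S.homology`.
  have hρ : ∀ φ, ρ φ ∈ LinearMap.range Ψ := by
    intro φ
    obtain ⟨a, ha⟩ := exists_factor (f := π) (g := ρ φ) hπ (by
      intro x hx
      obtain ⟨y, hy⟩ := (hπ0 x).mp hx
      have := congrArg (fun ψ => ψ y) φ.2
      rw [LinearMap.mem_ker]
      change φ.1 x.1 = 0
      rw [← hy]
      exact this)
    exact ⟨a, LinearMap.ext ha⟩
  let Φ : LinearMap.ker (precomp (k := k) E S.f.hom) →ₗ[k] (S.homology →ₗ[D] E) :=
    (LinearEquiv.ofInjective Ψ hΨ).symm.toLinearMap ∘ₗ ρ.codRestrict _ hρ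
  have hΦ : ∀ φ, Ψ (Φ φ) = ρ φ := by
    intro φ
    exact congrArg Subtype.val
      ((LinearEquiv.ofInjective Ψ hΨ).apply_symm_apply ⟨ρ φ, hρ φ⟩)
  have hsurj : Function.Surjective Φ := by
    intro a
    -- A functional on homology, pulled back to the cycles, extends to the middle term.
    obtain ⟨g, hg⟩ := h₂ (LinearMap.ker S.g.hom) (a ∘ₗ π)
    have hgk : g ∈ LinearMap.ker (precomp (k := k) E S.f.hom) := by
      refine LinearMap.mem_ker.mpr (LinearMap.ext fun y => ?_)
      have h1 := hg ⟨S.f.hom y, hS y⟩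
      have h2 : π ⟨S.f.hom y, hS y⟩ = 0 := (hπ0 _).mpr ⟨y, rfl⟩
      rw [LinearMap.comp_apply, h2, map_zero] at h1
      exact h1
    refine ⟨⟨g, hgk⟩, hΨ ?_⟩
    rw [hΦ]
    exact LinearMap.ext hg
  have hker : ∀ φ, Φ φ = 0 ↔ ϖ φ = 0 := by
    intro φ
    rw [hϖ0]
    constructor
    · intro h0
      have h1 : ρ φ = 0 := by rw [← hΦ, h0, map_zero]
      -- A functional vanishing on the cycles factors through the image of `S.g`; extending it to
      -- `S.X₃` by `h₃` exhibits it as a coboundary.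
      obtain ⟨a, ha⟩ := exists_factor (f := S.g.hom.rangeRestrict) (g := φ.1)
        (LinearMap.surjective_rangeRestrict _) (by
          intro x hx
          have hx' : x ∈ LinearMap.ker S.g.hom := congrArg Subtype.val (LinearMap.mem_ker.mp hx)
          exact congrArg (fun ψ => ψ ⟨x, hx'⟩) h1)
      obtain ⟨b, hb⟩ := h₃ _ a
      exact ⟨b, LinearMap.ext fun x => (hb (S.g.hom.rangeRestrict x)).trans (ha x)⟩
    · rintro ⟨b, hb⟩
      refine hΨ ?_
      rw [hΦ, map_zero]
      refine LinearMap.ext fun x => ?_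
      have h1 : b (S.g.hom x.1) = φ.1 x.1 := congrArg (fun ψ => ψ x.1) hb
      change φ.1 x.1 = 0
      rw [← h1, LinearMap.mem_ker.mp x.2, map_zero]
  have hk : LinearMap.ker Φ = LinearMap.ker ϖ := by
    ext φ
    exact hker φ
  exact ⟨(Φ.quotKerEquivOfSurjective hsurj).symm ≪≫ₗ Submodule.quotEquivOfEq _ _ hk ≪≫ₗ
    ϖ.quotKerEquivOfSurjective hϖ⟩

lemma nonempty_homComplex_homology_equiv (K : CochainComplex (ModuleCat.{max u v} D) ℕ)
    (E : Type u) [AddCommGroup E] [Module D E] [Module k E] [IsScalarTower k D E]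
    (h : ∀ p (Q : Submodule D (K.X p)) (f : Q →ₗ[D] E), ∃ g : K.X p →ₗ[D] E, ∀ y : Q, g y = f y)
    (p : ℕ) : Nonempty ((K.homology p →ₗ[D] E) ≃ₗ[k] (homComplex k K E).homology p) := by
  -- In degree `0` both conventions default to `l = 0`, where the differential is zero, so the edge
  -- case needs no separate treatment.
  have hprev : ∃ l, (ComplexShape.up ℕ).prev p = l ∧ (ComplexShape.down ℕ).next p = l := by
    cases p with
    | zero => exact ⟨0, CochainComplex.prev_nat_zero, ChainComplex.next_nat_zero⟩
    | succ p => exact ⟨p, CochainComplex.prev_nat_succ p, ChainComplex.next_nat_succ p⟩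
  obtain ⟨l, hl, hl'⟩ := hprev
  obtain ⟨e⟩ := nonempty_dual_homology_equiv (k := k) (K.sc' l p (p + 1)) E (h p) (h (p + 1))
    ((homComplex k K E).sc' (p + 1) p l) ((homComplex k K E).sc' (p + 1) p l).zero rfl
  let e₁ := (K.homologyIsoSc' l p (p + 1) hl (CochainComplex.next _ p)).toLinearEquiv
  let e₂ := ((homComplex k K E).homologyIsoSc' (p + 1) p l (ChainComplex.prev _ p)
    hl').toLinearEquiv
  let e₃ : (K.homology p →ₗ[D] E) ≃ₗ[k] ((K.sc' l p (p + 1)).homology →ₗ[D] E) :=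
    LinearEquiv.ofBijective (precomp (k := k) E e₁.symm.toLinearMap) (by
      constructor
      · intro a b hab
        refine LinearMap.ext fun y => ?_
        obtain ⟨x, rfl⟩ := e₁.symm.surjective y
        exact congrArg (fun φ => φ x) hab
      · intro a
        refine ⟨a ∘ₗ e₁.toLinearMap, LinearMap.ext fun y => ?_⟩
        exact congrArg a (e₁.apply_symm_apply y))
  exact ⟨e₃ ≪≫ₗ e ≪≫ₗ e₂.symm⟩

end DualHomology

end VarZero

end

theorem proposition3p3 {k : Type u} [Field k] (n : ℕ) {M : Type v} [AddCommGroup M]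
    [Module (VarZero.Diff k n) M] (hM : VarZero.IsVariationZero k n M) :
    Nonempty (VarZero.hypercubeComplex k n M ≅
      VarZero.degOne k n (VarZero.cech k n M Finset.univ)) ∧
    ∀ p : ℕ, Nonempty
      (VarZero.piece k n (VarZero.localCoh k n M Finset.univ p) Finset.univ ≃ₗ[k]
        (VarZero.hypercubeComplex k n M).homology p) := by
  refine ⟨⟨VarZero.hypercubeComplexIso hM⟩, fun p => ?_⟩
  obtain ⟨e⟩ := VarZero.nonempty_homComplex_homology_equiv (k := k)
    (VarZero.cech k n M Finset.univ) (VarZero.Inj k n Finset.univ)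
    (fun p => VarZero.extendsToInj_cech hM p) p
  let i := (HomologicalComplex.homologyFunctor _ _ p).mapIso (VarZero.hypercubeComplexIso hM)
  exact ⟨e ≪≫ₗ i.symm.toLinearEquiv⟩
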